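/- Conventions. Let $g\ge 2$ and $r\ge 1$ be integers, $\mathbf a=(a_1,\dots,a_r)$ with positive integers $a_j$, and $\mathbb Z_{\mathbf a}=\prod_j \mathbb Z/a_j\mathbb Z$. A function $f:\mathbb N_0\to\mathbb Z$ is $g$-additive if $f(\sum_{i=0}^m w_ig^i)=\sum_{i=0}^m f(w_ig^i)$ for all $m\ge 0$ and all digits $w_i\in\{0,\dots,g-1\}$. For $\mathbf f=(f_1,\dots,f_r)$ and $\mathbf b\in\mathbb Z_{\mathbf a}$, write $\mathbf f(n)\equiv\mathbf b\pmod{\mathbf a}$ if $f_j(n)\equiv b_j\pmod{a_j}$ for all $j$. A pair $(p,\ell)$ with $p\ge 1$, $\ell\ge 0$ is an eventual period of $\mathbf f$ with respect to $\mathbf a$ if $\mathbf f(dg^{i+np})\equiv\mathbf f(dg^i)\pmod{\mathbf a}$ for all $d\in\{0,\dots,g-1\}$, $n\ge1$ and $i\ge\ell$. Let $\Sigma\subseteq\{0,\dots,g-1\}^{\mathbb N_0}$ be a subshift (closed, and mapped into itself by the left shift). Its language $\mathcal L$ is the set of all finite prefixes (including the empty word) of its elements, and $\mathcal L^n$ is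 the set of words of length $n$ in $\mathcal L$. $\Sigma$ is mixing if for all $u,v\in\mathcal L$ there is $n$ such that for every $m\ge n$ some $w\in\mathcal L^m$ satisfies $uwv\in\mathcal L$. It is sofic if it is the set of label sequences of the infinite paths of a finite labelled directed multigraph. The follower set of $w\in\mathcal L$ is $F(w)=\{v\in\mathcal L: wv\in\mathcal L\}$. A word $w\in\mathcal L$ is synchronizing if for all $u,v\in\mathcal L$, $uw\in\mathcal L$ and $wv\in\mathcal L$ imply $uwv\in\mathcal L$. The Fischer cover of a mixing sofic $\Sigma$ is the labelled graph with node set $\mathcal V=\{F(w): w \text{ synchronizing}\}$ (a finite set) and an edge labelled $d$ from $F$ to $F'$ exactly when $F=F(w)$ and $F'=F(wd)$ for some $w\in\mathcal L$ with $wd\in\mathcal L$. $\Sigma$ is $k$-regular if every node of the Fischer cover has exactly $k$ outgoing and exactly $k$ incoming edges. For a word $w=w_0\cdots w_{n-1}$ put $(w)_g=\sum_{i<n} w_ig^i$, and let $A_\Sigma=\{(w)_g: w\in\mathcal L\}\subseteq\mathbb N_0$. For $\Sigma$ $k$-regular, $p\ge1$ and $i\ge 0$, let $M_i$ be the matrix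 indexed by $\mathbb Z_{\mathbf a}\times\mathcal V$ with entries $$M_i\big((\mathbf b,F),(\mathbf b',F')\big)=k^{-p}\,\Big|\Big\{w\in\mathcal L^p:\ \mathbf f(g^i(w)_g)\equiv\mathbf b'-\mathbf b\pmod{\mathbf a},\ w\text{ labels a path from }F\text{ to }F'\text{ in the Fischer cover}\Big\}\Big|.$$ The Markov condition for $(p,\ell)$ says that for every $i\ge\ell$ the matrix $M_i$ is irreducible (for all states $s,s'$ there is $n\ge1$ with $M_i^n(s,s')>0$) and aperiodic (for every state $s$, $\gcd\{n\ge1: M_i^n(s,s)>0\}=1$). Theorem. Let $\mathbf f=(f_1,\dots,f_r)$ be a collection of $g$-additive functions, let $\Sigma\subseteq\{0,\dots,g-1\}^{\mathbb N_0}$ be a mixing sofic subshift that is $k$-regular for some $k\ge 2$, and let $(p,\ell)$ be an eventual period of $\mathbf f$ with respect to $\mathbf a$ such that $\Sigma$ has a synchronizing word of length $\ell$. If the Markov condition holds for $(p,\ell)$, then $A_\Sigma$ is uniformly distributed $\mathbf f\pmod{\mathbf a}$: for every $\mathbf b\in\mathbb Z_{\mathbf a}$, $$\lim_{N\to\infty}\frac{|\{n\in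 A_\Sigma:\ \mathbf f(n)\equiv\mathbf b\pmod{\mathbf a}\}\cap[0,N)|}{|A_\Sigma\cap[0,N)|}=\frac1{a_1a_2\cdots a_r}.$$ -/

import Mathlib

open Filter Topology

noncomputable section

namespace DigitShift

/-! ### Markov matrices -/

/-- The period of a state `s`: the gcd of all `n ≥ 1` with `M ^ n (s, s) > 0`
(with `gcd ∅ = 0`). -/
def statePeriod {ι : Type*} [Fintype ι] [DecidableEq ι] (M : Matrix ι ι ℝ) (s : ι) : ℕ :=
  Nat.setGcd {n : ℕ | 1 ≤ n ∧ 0 < (M ^ n) s s}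

/-- A matrix is aperiodic if every state has period `1`. -/
def MatAperiodic {ι : Type*} [Fintype ι] [DecidableEq ι] (M : Matrix ι ι ℝ) : Prop :=
  ∀ s : ι, statePeriod M s = 1

/-! ### One-sided subshifts -/

/-- A one-sided subshift over the alphabet `{0, …, g - 1}`: a closed set of sequences which the
left shift maps into itself. -/
def IsSubshift {g : ℕ} (X : Set (ℕ → Fin g)) : Prop :=
  IsClosed X ∧ ∀ x ∈ X, (fun n => x (n + 1)) ∈ X

/-- The language of `X`: all finite prefixes (the empty one included) of sequences in `X`. -/
def lang {g : ℕ} (X : Set (ℕ → Fin g)) : Set (List (Fin g)) :=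
  {w | ∃ x ∈ X, ∀ (i : ℕ) (hi : i < w.length), x i = w[i]}

/-- Topological mixing, in terms of the language. -/
def IsMixing {g : ℕ} (X : Set (ℕ → Fin g)) : Prop :=
  ∀ u ∈ lang X, ∀ v ∈ lang X, ∃ n : ℕ, ∀ m ≥ n,
    ∃ w ∈ lang X, w.length = m ∧ u ++ w ++ v ∈ lang X

/-- A labelled directed multigraph with labels in `α`. -/
structure LabelledGraph (α : Type) where
  Node : Type
  Edge : Type
  source : Edge → Node
  target : Edge → Node
  label : Edge → α

namespace LabelledGraph

variable {α : Type}

/-- The set of all label sequences of infinite paths of `G`. -/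
def shift (G : LabelledGraph α) : Set (ℕ → α) :=
  {x | ∃ e : ℕ → G.Edge,
    (∀ j, G.source (e (j + 1)) = G.target (e j)) ∧ ∀ j, G.label (e j) = x j}

/-- `G.IsPath v π v'`: the list of edges `π` is a path from `v` to `v'`. -/
def IsPath (G : LabelledGraph α) : G.Node → List G.Edge → G.Node → Prop
  | v, [], v' => v = v'
  | v, e :: π, v' => G.source e = v ∧ G.IsPath (G.target e) π v'

/-- `G.Reads v w v'`: there is a path from `v` to `v'` labelled by the word `w`. -/
def Reads (G : LabelledGraph α) (v : G.Node) (w : List α) (v' : G.Node) : Prop :=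
  ∃ π : List G.Edge, G.IsPath v π v' ∧ π.map G.label = w

/-- Every node has exactly `k` outgoing and exactly `k` incoming edges. -/
def IsRegular (G : LabelledGraph α) (k : ℕ) : Prop :=
  ∀ v : G.Node, Nat.card {e : G.Edge // G.source e = v} = k ∧
    Nat.card {e : G.Edge // G.target e = v} = k

end LabelledGraph

/-- A set of sequences is sofic if it is presented by a finite labelled directed multigraph. -/
class IsSofic {g : ℕ} (X : Set (ℕ → Fin g)) : Prop where
  exists_cover : ∃ G : LabelledGraph (Fin g), Finite G.Node ∧ Finite G.Edge ∧ X = G.shift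

/-! ### Follower sets and the Fischer cover -/

/-- The follower set of a word. -/
def follower {g : ℕ} (X : Set (ℕ → Fin g)) (w : List (Fin g)) : Set (List (Fin g)) :=
  {v | v ∈ lang X ∧ w ++ v ∈ lang X}

/-- A word `w` of the language is synchronizing if `u w ∈ L` and `w v ∈ L` imply
`u w v ∈ L`. -/
def IsSynchronizing {g : ℕ} (X : Set (ℕ → Fin g)) (w : List (Fin g)) : Prop :=
  w ∈ lang X ∧ ∀ u ∈ lang X, ∀ v ∈ lang X,
    u ++ w ∈ lang X → w ++ v ∈ lang X → u ++ w ++ v ∈ lang X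

/-- The nodes of the Fischer cover: the follower sets of synchronizing words. -/
def FischerNode {g : ℕ} (X : Set (ℕ → Fin g)) : Type :=
  {F : Set (List (Fin g)) // ∃ w, IsSynchronizing X w ∧ follower X w = F}

/-- The Fischer cover. There is an edge from `F` to `F'` labelled by `d` exactly when
`F = F(w)` and `F' = F(w d)` for a word `w` with `w d` in the language. -/
def fischerCover {g : ℕ} (X : Set (ℕ → Fin g)) : LabelledGraph (Fin g) where
  Node := FischerNode X
  Edge := {e : FischerNode X × Fin g × FischerNode X //
    ∃ w ∈ lang X, follower X w = e.1.1 ∧ w ++ [e.2.1] ∈ lang X ∧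
      follower X (w ++ [e.2.1]) = e.2.2.1}
  source e := e.1.1
  target e := e.1.2.2
  label e := e.1.2.1

theorem mem_lang_shift_append {g : ℕ} (G : LabelledGraph (Fin g)) (w v : List (Fin g)) :
    w ++ v ∈ lang G.shift ↔ ∃ n : G.Node,
      (∃ e : ℕ → G.Edge, (∀ j, G.source (e (j + 1)) = G.target (e j)) ∧
        (∀ (i : ℕ) (hi : i < w.length), G.label (e i) = w[i]) ∧
        G.source (e w.length) = n) ∧
      (∃ e : ℕ → G.Edge, (∀ j, G.source (e (j + 1)) = G.target (e j)) ∧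
        (∀ (i : ℕ) (hi : i < v.length), G.label (e i) = v[i]) ∧ G.source (e 0) = n) := by
  constructor
  · rintro ⟨x, ⟨e, he, hl⟩, hx⟩
    refine ⟨G.source (e w.length), ⟨e, he, ?_, rfl⟩,
      ⟨fun j => e (w.length + j), fun j => he _, ?_, rfl⟩⟩
    · intro i hi
      rw [hl, hx i (by simp; omega), List.getElem_append_left hi]
    · intro i hi
      rw [hl, hx (w.length + i) (by simp; omega), List.getElem_append_right (by omega)]
      simp
  · rintro ⟨n, ⟨e, he, hw, hn⟩, ⟨e', he', hv, hn'⟩⟩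
    refine ⟨fun j => G.label (if j < w.length then e j else e' (j - w.length)),
      ⟨fun j => if j < w.length then e j else e' (j - w.length), ?_, fun j => rfl⟩, ?_⟩
    · intro j
      rcases lt_trichotomy (j + 1) w.length with h | h | h
      · simp [h, show j < w.length by omega, he]
      · have h1 : ¬ (j + 1 < w.length) := by omega
        have h2 : j < w.length := by omega
        simp only [h1, h2, if_true, if_false]
        rw [← he j, h, Nat.sub_self, hn, hn']
      · have h1 : ¬ (j + 1 < w.length) := by omega
        have h2 : ¬ (j < w.length) := by omega
        simp only [h1, h2, if_false]
        rw [← he', show j + 1 - w.length = j - w.length + 1 by omega]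
    · intro i hi
      by_cases h : i < w.length
      · simp [h, hw i h]
      · simp only [h, if_false]
        rw [List.getElem_append_right (by omega)]
        exact hv _ _

/-- A sofic shift has only finitely many follower sets, so its Fischer cover is finite. -/
instance finite_fischerNode {g : ℕ} (X : Set (ℕ → Fin g)) [hX : IsSofic X] :
    Finite (FischerNode X) := by
  obtain ⟨G, hN, -, rfl⟩ := hX.exists_cover
  let T : List (Fin g) → Set G.Node := fun w => {n | ∃ e : ℕ → G.Edge,
    (∀ j, G.source (e (j + 1)) = G.target (e j)) ∧
      (∀ (i : ℕ) (hi : i < w.length), G.label (e i) = w[i]) ∧ G.source (e w.length) = n}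
  have key : ∀ w w', T w = T w' → follower G.shift w = follower G.shift w' := by
    intro w w' h
    ext v
    have h' : ∀ n, n ∈ T w ↔ n ∈ T w' := fun n => by rw [h]
    simp only [follower, Set.mem_ofPred_eq, mem_lang_shift_append]
    refine and_congr_right fun _ => exists_congr fun n => and_congr_left fun _ => h' n
  refine Finite.of_injective
    (fun F : FischerNode G.shift => T (Classical.choose F.2)) ?_
  intro F F' h
  have h1 := (Classical.choose_spec F.2).2
  have h2 := (Classical.choose_spec F'.2).2
  exact Subtype.ext (by rw [← h1, ← h2]; exact key _ _ h)

instance fintypeFischerNode {g : ℕ} (X : Set (ℕ → Fin g)) [IsSofic X] :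
    Fintype (FischerNode X) := Fintype.ofFinite _

/-! ### Digits, additive functions, and uniform distribution -/

/-- The integer `w₀ + w₁ g + ⋯ + w_{n-1} g ^ (n-1)` represented by the word `w`. -/
def wordValue {g : ℕ} (w : List (Fin g)) : ℕ :=
  Nat.ofDigits g (w.map Fin.val)

/-- The `g`-language set of `X`. -/
def languageSet {g : ℕ} (X : Set (ℕ → Fin g)) : Set ℕ :=
  {n | ∃ w ∈ lang X, wordValue w = n}

/-- `g`-additive functions. -/
def IsAdditiveBase (g : ℕ) (f : ℕ → ℤ) : Prop :=
  ∀ (m : ℕ) (w : ℕ → ℕ), (∀ i, w i < g) →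
    f (∑ i ∈ Finset.range (m + 1), w i * g ^ i) = ∑ i ∈ Finset.range (m + 1), f (w i * g ^ i)

/-- `f(n) ≡ b (mod a)`, componentwise. -/
def CongrMod {r : ℕ} (f : Fin r → ℕ → ℤ) (a : Fin r → ℕ) (n : ℕ) (b : ∀ j, ZMod (a j)) : Prop :=
  ∀ j, ((f j n : ℤ) : ZMod (a j)) = b j

/-- `(p, l)` is an eventual period of `f` with respect to `a` in base `g`. -/
def IsEventualPeriod (g : ℕ) {r : ℕ} (f : Fin r → ℕ → ℤ) (a : Fin r → ℕ) (p l : ℕ) : Prop :=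
  1 ≤ p ∧ ∀ d < g, ∀ n ≥ 1, ∀ i ≥ l, ∀ j,
    f j (d * g ^ (i + n * p)) ≡ f j (d * g ^ i) [ZMOD (a j)]

/-- The set `A` is uniformly distributed `f` mod `a`. -/
def IsUniformlyDistributed {r : ℕ} (f : Fin r → ℕ → ℤ) (a : Fin r → ℕ) (A : Set ℕ) : Prop :=
  ∀ b : (∀ j, ZMod (a j)),
    Tendsto (fun N : ℕ =>
        (({n ∈ A | CongrMod f a n b} ∩ Set.Ico 0 N).ncard : ℝ) / ((A ∩ Set.Ico 0 N).ncard : ℝ))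
      atTop (𝓝 (1 / ∏ j, (a j : ℝ)))

/-! ### The transition matrices and the Markov condition -/

/-- The set `E_i(b, F, F')`: words `w` of length `p` in the language with
`f(g ^ i (w)_g) ≡ b (mod a)` that label a path from `F` to `F'` in the Fischer cover. -/
def extensionSet {g r : ℕ} (X : Set (ℕ → Fin g)) (f : Fin r → ℕ → ℤ) (a : Fin r → ℕ)
    (p i : ℕ) (b : ∀ j, ZMod (a j)) (F F' : FischerNode X) : Set (List (Fin g)) :=
  {w | w ∈ lang X ∧ w.length = p ∧ CongrMod f a (g ^ i * wordValue w) b ∧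
    (fischerCover X).Reads F w F'}

/-- The state space `ℤ_a × V`. -/
abbrev State {g r : ℕ} (X : Set (ℕ → Fin g)) (a : Fin r → ℕ) : Type :=
  (∀ j, ZMod (a j)) × FischerNode X

/-- The matrix `M_i` with entries `k ^ (-p) * |E_i(b' - b, F, F')|`. -/
def transitionMatrix {g r : ℕ} (X : Set (ℕ → Fin g)) (f : Fin r → ℕ → ℤ) (a : Fin r → ℕ)
    (k p i : ℕ) : Matrix (State X a) (State X a) ℝ :=
  fun s s' => ((k : ℝ) ^ p)⁻¹ * ((extensionSet X f a p i (s'.1 - s.1) s.2 s'.2).ncard : ℝ)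

open Classical in
/-- The Markov condition: `M_i` is irreducible and aperiodic for every `i ≥ l`. -/
def MarkovCondition {g r : ℕ} (X : Set (ℕ → Fin g)) [IsSofic X] (f : Fin r → ℕ → ℤ)
    (a : Fin r → ℕ) [∀ j, NeZero (a j)] (k p l : ℕ) : Prop :=
  ∀ i ≥ l, (transitionMatrix X f a k p i).IsIrreducible ∧
    MatAperiodic (transitionMatrix X f a k p i)

end DigitShift

end

open DigitShift

/-! Reading a word digit by digit is a walk on `State X a`: the first coordinate accumulates
residues of `f`, the second follows the Fischer cover. From position `i ≥ l` on, periodicity makes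
`p`-blocks act by one matrix, so its `m`-th power counts words of length `p * m` between two states
(`transitionMatrix_pow_apply`). Incoming regularity gives column sums `1`. Irreducibility and
aperiodicity then make each row of a high power almost constant (`exists_pow_row_oscillation_le`):
the number of words from a fixed state to `(b, F')` hardly depends on `b`.

A walk needs a starting node, which a synchronizing prefix supplies; prefixes that are not
synchronizing are exponentially rare (`wordSum_not_synchronizing_le`). Hence for some length `n` the
words `u` with `u ++ t` in the language are almost equidistributed over residues, uniformly in `t`
(`exists_prefixCount_le`).

Integers are cut into blocks of length `g ^ n` with fixed high digits `t`. A nonempty block away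
from the origin has at least `k ^ n / |V|` elements of the language set, so the error is a small
proportion of the block; summing over blocks gives `exists_countBelow_le`, and the limit follows
because the count is unbounded. -/

namespace DigitShift

/-! ### Convergence of powers of irreducible aperiodic matrices. -/

section Matrices

variable {ι : Type*} [Fintype ι] [DecidableEq ι]

theorem pow_apply_nonneg {M : Matrix ι ι ℝ} (hM : ∀ i j, 0 ≤ M i j) (n : ℕ) (i j : ι) :
    0 ≤ (M ^ n) i j := by
  induction n generalizing j with
  | zero => rw [pow_zero, Matrix.one_apply]; split_ifs <;> norm_num
  | succ n ih =>
    rw [pow_succ, Matrix.mul_apply]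
    exact Finset.sum_nonneg fun x _ => mul_nonneg (ih x) (hM x j)

theorem pow_add_apply_pos {M : Matrix ι ι ℝ} (hM : ∀ i j, 0 ≤ M i j) {m n : ℕ} {i x j : ι}
    (h₁ : 0 < (M ^ m) i x) (h₂ : 0 < (M ^ n) x j) : 0 < (M ^ (m + n)) i j := by
  rw [pow_add, Matrix.mul_apply]
  exact Finset.sum_pos' (fun y _ => mul_nonneg (pow_apply_nonneg hM m i y)
    (pow_apply_nonneg hM n y j)) ⟨x, Finset.mem_univ x, mul_pos h₁ h₂⟩

/-- The return times to a state of period `1` contain all large integers. -/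
theorem exists_forall_pow_apply_self_pos {M : Matrix ι ι ℝ} (hM : ∀ i j, 0 ≤ M i j) {s : ι}
    (hs : statePeriod M s = 1) : ∃ n₀, ∀ n ≥ n₀, 0 < (M ^ n) s s := by
  -- Return times are closed under addition, and the additive closure of a set contains all large
  -- multiples of its gcd.
  obtain ⟨n₀, h⟩ := Nat.exists_mem_closure_of_ge {n : ℕ | 1 ≤ n ∧ 0 < (M ^ n) s s}
  refine ⟨n₀, fun n hn => ?_⟩
  have hdvd : Nat.setGcd {n : ℕ | 1 ≤ n ∧ 0 < (M ^ n) s s} ∣ n := by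
    rw [show Nat.setGcd {n : ℕ | 1 ≤ n ∧ 0 < (M ^ n) s s} = 1 from hs]
    exact one_dvd n
  refine AddSubmonoid.closure_induction (motive := fun n _ => 0 < (M ^ n) s s)
    (fun x hx => hx.2) (by simp) (fun x y _ _ hx hy => pow_add_apply_pos hM hx hy) (h n hn hdvd)

theorem exists_pow_pos_of_aperiodic [Nonempty ι] {M : Matrix ι ι ℝ} (hirr : M.IsIrreducible)
    (hap : MatAperiodic M) : ∃ n, ∀ i j, 0 < (M ^ n) i j := by
  have hM := hirr.nonneg
  choose n₀ hn₀ using fun s => exists_forall_pow_apply_self_pos hM (hap s)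
  choose m _ hm using (Matrix.isIrreducible_iff_exists_pow_pos hM).1 hirr
  -- One exponent must serve all pairs: the surplus time is spent returning to `i`, then `m i j`
  -- steps lead to `j`.
  refine ⟨∑ s, n₀ s + ∑ i, ∑ j, m i j, fun i j => ?_⟩
  have h₁ : m i j ≤ ∑ i, ∑ j, m i j :=
    (Finset.single_le_sum (f := fun j => m i j) (fun _ _ => Nat.zero_le _)
      (Finset.mem_univ j)).trans
      (Finset.single_le_sum (f := fun i => ∑ j, m i j) (fun _ _ => Nat.zero_le _)
        (Finset.mem_univ i))
  have h₂ : n₀ i ≤ ∑ s, n₀ s :=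
    Finset.single_le_sum (f := n₀) (fun _ _ => Nat.zero_le _) (Finset.mem_univ i)
  have h₃ := pow_add_apply_pos hM
    (hn₀ i (∑ s, n₀ s + ∑ i, ∑ j, m i j - m i j) (by omega)) (hm i j)
  rwa [Nat.sub_add_cancel (by omega)] at h₃

theorem pow_col_sum {M : Matrix ι ι ℝ} (hcol : ∀ j, ∑ i, M i j = 1) (n : ℕ) (j : ι) :
    ∑ i, (M ^ n) i j = 1 := by
  induction n with
  | zero => simp [Matrix.one_apply]
  | succ n ih =>
    simp only [pow_succ', Matrix.mul_apply]
    rw [Finset.sum_comm]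
    simp_rw [← Finset.sum_mul, hcol, one_mul]
    exact ih

omit [DecidableEq ι] in
/-- Averaging with positive weights contracts the oscillation of a vector. -/
theorem oscillation_vecMul_le [Nonempty ι] {P : Matrix ι ι ℝ} {ε : ℝ}
    (hP : ∀ i j, ε ≤ P i j) (hε : 0 ≤ ε) (hε1 : ε ≤ 1) (hcol : ∀ j, ∑ i, P i j = 1)
    {x : ι → ℝ} {c : ℝ} (hx : ∀ i j, x i ≤ x j + c) (i j : ι) :
    ∑ s, x s * P s i ≤ ∑ s, x s * P s j + (1 - ε) * c := by
  obtain ⟨u, hu⟩ := Finite.exists_max x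
  obtain ⟨v, hv⟩ := Finite.exists_min x
  -- The weight at the minimizer `v` alone pulls every average at least `ε * (x u - x v)` below the
  -- maximum.
  have h₁ : ε * (x u - x v) ≤ ∑ s, (x u - x s) * P s i := by
    refine le_trans ?_ (Finset.single_le_sum (f := fun s => (x u - x s) * P s i)
      (fun s _ => mul_nonneg (sub_nonneg.2 (hu s)) (hε.trans (hP s i))) (Finset.mem_univ v))
    rw [mul_comm]
    exact mul_le_mul_of_nonneg_left (hP v i) (sub_nonneg.2 (hu v))
  have h₂ : 0 ≤ ∑ s, (x s - x v) * P s j :=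
    Finset.sum_nonneg fun s _ => mul_nonneg (sub_nonneg.2 (hv s)) (hε.trans (hP s j))
  simp only [sub_mul, Finset.sum_sub_distrib, ← Finset.mul_sum, hcol, mul_one] at h₁ h₂
  have h₃ : (1 - ε) * (x u - x v) ≤ (1 - ε) * c :=
    mul_le_mul_of_nonneg_left (by linarith [hx u v]) (by linarith)
  linarith

/-- Powers of an irreducible aperiodic matrix with column sums `1` have rows that are eventually
almost constant. -/
theorem exists_pow_row_oscillation_le {M : Matrix ι ι ℝ} (hirr : M.IsIrreducible)
    (hap : MatAperiodic M) (hcol : ∀ j, ∑ i, M i j = 1) {δ : ℝ} (hδ : 0 < δ) :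
    ∃ m, ∀ s i j, (M ^ m) s i ≤ (M ^ m) s j + δ := by
  cases isEmpty_or_nonempty ι with
  | inl h => exact ⟨0, fun s => isEmptyElim s⟩
  | inr h =>
  obtain ⟨n, hn⟩ := exists_pow_pos_of_aperiodic hirr hap
  obtain ⟨u, hu⟩ := Finite.exists_min fun q : ι × ι => (M ^ n) q.1 q.2
  set ε := (M ^ n) u.1 u.2
  have hε : 0 < ε := hn _ _
  have hle1 : ∀ m i j, (M ^ m) i j ≤ 1 := fun m i j => by
    rw [← pow_col_sum hcol m j]
    exact Finset.single_le_sum (f := fun i => (M ^ m) i j)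
      (fun i _ => pow_apply_nonneg hirr.nonneg m i j) (Finset.mem_univ i)
  have hε1 : ε ≤ 1 := hle1 n _ _
  -- Each factor `M ^ n` has entries at least `ε`, so it contracts the oscillation of a row by `1 -
  -- ε`; initially entries lie in `[0, 1]`.
  have key : ∀ m s i j, (M ^ (n * m)) s i ≤ (M ^ (n * m)) s j + (1 - ε) ^ m := by
    intro m s
    induction m with
    | zero =>
      intro i j
      have h₁ := hle1 (n * 0) s i
      have h₂ := pow_apply_nonneg hirr.nonneg (n * 0) s j
      rw [pow_zero (1 - ε)]
      linarith
    | succ m ih =>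
      intro i j
      rw [Nat.mul_succ, pow_add, Matrix.mul_apply, Matrix.mul_apply, pow_succ' (1 - ε)]
      exact oscillation_vecMul_le (fun i j => hu (i, j)) hε.le hε1 (pow_col_sum hcol n) ih i j
  obtain ⟨m, hm⟩ := exists_pow_lt_of_lt_one hδ (show 1 - ε < 1 by linarith)
  exact ⟨n * m, fun s i j => (key m s i j).trans (by linarith)⟩

end Matrices

/-! ### Sums over words -/

section Words

open Classical in
/-- The indicator of a proposition. -/
noncomputable def ind (P : Prop) : ℝ := if P then 1 else 0

theorem ind_of {P : Prop} (h : P) : ind P = 1 := if_pos h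

theorem ind_of_not {P : Prop} (h : ¬P) : ind P = 0 := if_neg h

theorem ind_nonneg (P : Prop) : 0 ≤ ind P := by
  unfold ind; split_ifs <;> norm_num

theorem ind_le_one (P : Prop) : ind P ≤ 1 := by
  unfold ind; split_ifs <;> norm_num

theorem ind_mono {P Q : Prop} (h : P → Q) : ind P ≤ ind Q := by
  by_cases hP : P
  · rw [ind_of hP, ind_of (h hP)]
  · rw [ind_of_not hP]; exact ind_nonneg Q

theorem ind_and (P Q : Prop) : ind (P ∧ Q) = ind P * ind Q := by
  by_cases hP : P <;> by_cases hQ : Q <;> simp [ind, hP, hQ]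

theorem ind_and_add_ind_and_not (P Q : Prop) : ind (P ∧ Q) + ind (P ∧ ¬Q) = ind P := by
  by_cases hP : P <;> by_cases hQ : Q <;> simp [ind, hP, hQ]

/-- Determinism of the Fischer cover enters the counts through this lemma: a sum over end nodes
collapses to the existence of a path. -/
theorem sum_ind_of_unique {κ : Type*} [Fintype κ] {P : κ → Prop}
    (h : ∀ x y, P x → P y → x = y) : ∑ x, ind (P x) = ind (∃ x, P x) := by
  by_cases hP : ∃ x, P x
  · obtain ⟨x, hx⟩ := hP
    rw [ind_of ⟨x, hx⟩, Finset.sum_eq_single x, ind_of hx]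
    · exact fun y _ hy => ind_of_not fun hy' => hy (h y x hy' hx)
    · simp
  · rw [ind_of_not hP]
    exact Finset.sum_eq_zero fun x _ => ind_of_not fun hx => hP ⟨x, hx⟩

theorem ind_exists_le_sum {κ : Type*} [Fintype κ] (P : κ → Prop) :
    ind (∃ x, P x) ≤ ∑ x, ind (P x) := by
  by_cases hP : ∃ x, P x
  · obtain ⟨x, hx⟩ := hP
    rw [ind_of ⟨x, hx⟩, ← ind_of hx]
    exact Finset.single_le_sum (f := fun x => ind (P x)) (fun x _ => ind_nonneg _)
      (Finset.mem_univ x)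
  · rw [ind_of_not hP]
    exact Finset.sum_nonneg fun x _ => ind_nonneg _

theorem sum_ind_eq_natCard {κ : Type*} [Fintype κ] (P : κ → Prop) :
    ∑ x, ind (P x) = (Nat.card {x // P x} : ℝ) := by
  classical
  rw [Nat.card_eq_fintype_card, Fintype.card_subtype, Finset.card_eq_sum_ones, Nat.cast_sum,
    Finset.sum_filter]
  exact Finset.sum_congr rfl fun x _ => by simp [ind]

variable {g : ℕ}

/-- The sum of `φ w` over all words `w` of length `n`. -/
noncomputable def wordSum : ℕ → (List (Fin g) → ℝ) → ℝ
  | 0, φ => φ []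
  | n + 1, φ => ∑ d, wordSum n fun w => φ (d :: w)

theorem wordSum_mono {n : ℕ} {φ ψ : List (Fin g) → ℝ}
    (h : ∀ w, w.length = n → φ w ≤ ψ w) : wordSum n φ ≤ wordSum n ψ := by
  induction n generalizing φ ψ with
  | zero => exact h [] rfl
  | succ n ih =>
    exact Finset.sum_le_sum fun d _ => ih fun w hw => h (d :: w) (by simp [hw])

theorem wordSum_congr {n : ℕ} {φ ψ : List (Fin g) → ℝ}
    (h : ∀ w, w.length = n → φ w = ψ w) : wordSum n φ = wordSum n ψ :=
  le_antisymm (wordSum_mono fun w hw => (h w hw).le) (wordSum_mono fun w hw => (h w hw).ge)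

theorem wordSum_mul_right (n : ℕ) (φ : List (Fin g) → ℝ) (c : ℝ) :
    wordSum n (fun w => φ w * c) = wordSum n φ * c := by
  induction n generalizing φ with
  | zero => rfl
  | succ n ih => simp only [wordSum, ih, Finset.sum_mul]

theorem wordSum_mul_left (n : ℕ) (φ : List (Fin g) → ℝ) (c : ℝ) :
    wordSum n (fun w => c * φ w) = c * wordSum n φ := by
  simp only [mul_comm c, wordSum_mul_right]

theorem wordSum_sum {κ : Type*} (s : Finset κ) (n : ℕ) (φ : κ → List (Fin g) → ℝ) :
    wordSum n (fun w => ∑ x ∈ s, φ x w) = ∑ x ∈ s, wordSum n (φ x) := by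
  induction n generalizing φ with
  | zero => rfl
  | succ n ih =>
    simp only [wordSum, ih]
    exact Finset.sum_comm

theorem wordSum_add (n : ℕ) (φ ψ : List (Fin g) → ℝ) :
    wordSum n (fun w => φ w + ψ w) = wordSum n φ + wordSum n ψ := by
  induction n generalizing φ ψ with
  | zero => rfl
  | succ n ih => simp only [wordSum, ih, Finset.sum_add_distrib]

theorem wordSum_nonneg {n : ℕ} {φ : List (Fin g) → ℝ} (h : ∀ w, 0 ≤ φ w) :
    0 ≤ wordSum n φ := by
  induction n generalizing φ with
  | zero => exact h []
  | succ n ih => exact Finset.sum_nonneg fun d _ => ih fun w => h (d :: w)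

theorem wordSum_append (m n : ℕ) (φ : List (Fin g) → ℝ) :
    wordSum (m + n) φ = wordSum m fun u => wordSum n fun v => φ (u ++ v) := by
  induction m generalizing φ with
  | zero => simp [wordSum]
  | succ m ih => rw [Nat.succ_add]; simp only [wordSum, ih, List.cons_append]

theorem wordSum_ind_eq (u : List (Fin g)) : wordSum u.length (fun w => ind (w = u)) = 1 := by
  induction u with
  | nil => exact ind_of rfl
  | cons d u ih =>
    simp only [List.length_cons, wordSum, List.cons.injEq, ind_and, wordSum_mul_left, ih, mul_one]
    rw [sum_ind_of_unique (by rintro _ _ rfl rfl; rfl), ind_of ⟨d, rfl⟩]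

theorem wordSum_ind_mem {n : ℕ} {S : Set (List (Fin g))} (hS : ∀ w ∈ S, w.length = n) :
    wordSum n (fun w => ind (w ∈ S)) = (S.ncard : ℝ) := by
  have hfin : S.Finite := (List.finite_length_eq (Fin g) n).subset hS
  have h : ∀ w, ind (w ∈ S) = ∑ u ∈ hfin.toFinset, ind (w = u) := by
    intro w
    by_cases hw : w ∈ S
    · rw [ind_of hw, Finset.sum_eq_single w, ind_of rfl]
      · exact fun u _ hu => ind_of_not hu.symm
      · exact fun h => (h (hfin.mem_toFinset.2 hw)).elim
    · rw [ind_of_not hw, Finset.sum_eq_zero]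
      rintro u hu
      refine ind_of_not ?_
      rintro rfl
      exact hw (hfin.mem_toFinset.1 hu)
  simp_rw [h]
  rw [wordSum_sum, Finset.sum_congr rfl (g := fun _ => (1 : ℝ))]
  · rw [Finset.sum_const, nsmul_eq_mul, mul_one, Set.ncard_eq_toFinset_card S hfin]
  · intro u hu
    rw [← hS u (hfin.mem_toFinset.1 hu)]
    exact wordSum_ind_eq u

/-! ### The language and synchronizing words -/

variable {X : Set (ℕ → Fin g)}

theorem mem_lang_of_append_left {u v : List (Fin g)} (h : u ++ v ∈ lang X) : u ∈ lang X := by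
  obtain ⟨x, hx, hw⟩ := h
  refine ⟨x, hx, fun i hi => ?_⟩
  rw [hw i (by simp; omega), List.getElem_append_left hi]

theorem mem_lang_of_cons (hX : IsSubshift X) {d : Fin g} {v : List (Fin g)}
    (h : d :: v ∈ lang X) : v ∈ lang X := by
  obtain ⟨x, hx, hw⟩ := h
  refine ⟨_, hX.2 x hx, fun i hi => ?_⟩
  rw [hw (i + 1) (by simpa using hi), List.getElem_cons_succ]

theorem mem_lang_of_append_right (hX : IsSubshift X) {u v : List (Fin g)}
    (h : u ++ v ∈ lang X) : v ∈ lang X := by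
  induction u with
  | nil => exact h
  | cons d u ih => exact ih (mem_lang_of_cons hX h)

theorem mem_follower_append (hX : IsSubshift X) {w u v : List (Fin g)} :
    v ∈ follower X (w ++ u) ↔ u ++ v ∈ follower X w := by
  simp only [follower, Set.mem_ofPred_eq, List.append_assoc]
  exact ⟨fun h => ⟨mem_lang_of_append_right hX h.2, h.2⟩,
    fun h => ⟨mem_lang_of_append_right hX h.1, h.2⟩⟩

theorem mem_follower (hX : IsSubshift X) {w v : List (Fin g)} :
    v ∈ follower X w ↔ w ++ v ∈ lang X :=
  ⟨fun h => h.2, fun h => ⟨mem_lang_of_append_right hX h, h⟩⟩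

theorem follower_append_congr (hX : IsSubshift X) {w w' : List (Fin g)}
    (h : follower X w = follower X w') (u : List (Fin g)) :
    follower X (w ++ u) = follower X (w' ++ u) := by
  ext v
  rw [mem_follower_append hX, mem_follower_append hX, h]

theorem append_mem_lang_congr (hX : IsSubshift X) {w w' : List (Fin g)}
    (h : follower X w = follower X w') (u : List (Fin g)) :
    w ++ u ∈ lang X ↔ w' ++ u ∈ lang X := by
  rw [← mem_follower hX, h, mem_follower hX]

/-- Together with `IsSynchronizing.append_left`: a word of the language with a synchronizing factor
is synchronizing, since left and right contexts can be glued at that factor. -/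
theorem IsSynchronizing.append_right (hX : IsSubshift X) {u v : List (Fin g)}
    (hu : IsSynchronizing X u) (huv : u ++ v ∈ lang X) : IsSynchronizing X (u ++ v) := by
  refine ⟨huv, fun x hx y _ hxu hy => ?_⟩
  rw [List.append_assoc] at hy
  rw [← List.append_assoc] at hxu
  rw [← List.append_assoc, List.append_assoc (x ++ u)]
  exact hu.2 x hx (v ++ y) (mem_lang_of_append_right hX hy) (mem_lang_of_append_left hxu) hy

theorem IsSynchronizing.append_left (hX : IsSubshift X) {u v : List (Fin g)}
    (hv : IsSynchronizing X v) (huv : u ++ v ∈ lang X) : IsSynchronizing X (u ++ v) := by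
  refine ⟨huv, fun x _ y hy hxu huy => ?_⟩
  rw [← List.append_assoc] at hxu ⊢
  rw [List.append_assoc] at huy
  exact hv.2 (x ++ u) (mem_lang_of_append_left hxu) y hy hxu (mem_lang_of_append_right hX huy)

/-! ### Reading words in the Fischer cover -/

/-- The follower set that a node of the Fischer cover stands for. -/
def FischerNode.words (F : FischerNode X) : Set (List (Fin g)) := F.1

theorem FischerNode.ext {F F' : FischerNode X} (h : F.words = F'.words) : F = F' :=
  Subtype.ext h

theorem FischerNode.ext_iff {F F' : FischerNode X} : F = F' ↔ F.words = F'.words :=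
  ⟨fun h => h ▸ rfl, FischerNode.ext⟩

/-- The node of the Fischer cover given by a synchronizing word. -/
def FischerNode.ofWord {w : List (Fin g)} (hw : IsSynchronizing X w) : FischerNode X :=
  ⟨follower X w, w, hw, rfl⟩

/-- The Fischer cover has a path from `F` to `F'` labelled by `w`. -/
def NodeReads (F : FischerNode X) (w : List (Fin g)) (F' : FischerNode X) : Prop :=
  (fischerCover X).Reads F w F'

/-- The Fischer cover has an edge from `F` to `F'` labelled by `d`. -/
def IsFischerEdge (F : FischerNode X) (d : Fin g) (F' : FischerNode X) : Prop :=
  ∃ w ∈ lang X, follower X w = F.words ∧ w ++ [d] ∈ lang X ∧ follower X (w ++ [d]) = F'.words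

theorem reads_nil {F F' : FischerNode X} : NodeReads F [] F' ↔ F = F' := by
  constructor
  · rintro ⟨π, h, hπ⟩
    rw [List.map_eq_nil_iff] at hπ
    subst hπ
    exact h
  · exact fun h => ⟨[], h, rfl⟩

theorem reads_cons {F F' : FischerNode X} {d : Fin g} {w : List (Fin g)} :
    NodeReads F (d :: w) F' ↔
      ∃ F₁, IsFischerEdge F d F₁ ∧ NodeReads F₁ w F' := by
  constructor
  · rintro ⟨π, h, hπ⟩
    cases π with
    | nil => simp at hπ
    | cons e π =>
      rw [List.map_cons, List.cons.injEq] at hπ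
      obtain ⟨rfl, hw⟩ := hπ
      obtain ⟨rfl, h₂⟩ := h
      exact ⟨_, e.2, π, h₂, hw⟩
  · rintro ⟨F₁, he, π, h, hw⟩
    exact ⟨⟨(F, d, F₁), he⟩ :: π, ⟨rfl, h⟩, congrArg (d :: ·) hw⟩

theorem reads_append {F F' : FischerNode X} {u v : List (Fin g)} :
    NodeReads F (u ++ v) F' ↔
      ∃ F₁, NodeReads F u F₁ ∧ NodeReads F₁ v F' := by
  induction u generalizing F with
  | nil => simp [reads_nil]
  | cons d u ih =>
    simp only [List.cons_append, reads_cons, ih]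
    exact ⟨fun ⟨F₂, he, F₁, h₁, h₂⟩ => ⟨F₁, ⟨F₂, he, h₁⟩, h₂⟩,
      fun ⟨F₁, ⟨F₂, he, h₁⟩, h₂⟩ => ⟨F₂, he, F₁, h₁, h₂⟩⟩

theorem FischerNode.exists_follower_eq (F : FischerNode X) :
    ∃ w, IsSynchronizing X w ∧ follower X w = F.words := F.2

theorem mem_lang_of_follower_eq (hX : IsSubshift X) {F : FischerNode X} {q : List (Fin g)}
    (hq : follower X q = F.words) : q ∈ lang X := by
  obtain ⟨w, hw, hF⟩ := F.exists_follower_eq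
  have := (append_mem_lang_congr hX (hq.trans hF.symm) []).2 (by simpa using hw.1)
  simpa using this

theorem isFischerEdge_iff (hX : IsSubshift X) {F F' : FischerNode X} {d : Fin g}
    {q : List (Fin g)} (hq : follower X q = F.words) :
    IsFischerEdge F d F' ↔ q ++ [d] ∈ lang X ∧ follower X (q ++ [d]) = F'.words := by
  constructor
  · rintro ⟨w, _, hwF, hwd, hF'⟩
    exact ⟨(append_mem_lang_congr hX (hq.trans hwF.symm) _).2 hwd,
      (follower_append_congr hX (hq.trans hwF.symm) _).trans hF'⟩
  · exact fun h => ⟨q, mem_lang_of_follower_eq hX hq, hq, h⟩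

/-- The word `q` need not be synchronizing; a synchronizing `w` with the same follower set replaces
it, and `w ++ u` is again synchronizing. -/
theorem exists_node_of_append_mem_lang (hX : IsSubshift X) {F : FischerNode X}
    {q u : List (Fin g)} (hq : follower X q = F.words) (h : q ++ u ∈ lang X) :
    ∃ F' : FischerNode X, follower X (q ++ u) = F'.words := by
  obtain ⟨w, hw, hF⟩ := F.exists_follower_eq
  have hwu := (append_mem_lang_congr hX (hF.trans hq.symm) u).2 h
  exact ⟨FischerNode.ofWord (hw.append_right hX hwu),
    follower_append_congr hX (hq.trans hF.symm) u⟩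

/-- The follower set of `q ++ w` depends on `q` only through its follower set, so any representative
`q` of `F` can be used to trace the path. Determinism of the cover is a consequence. -/
theorem reads_iff (hX : IsSubshift X) {F F' : FischerNode X} {q w : List (Fin g)}
    (hq : follower X q = F.words) :
    NodeReads F w F' ↔ q ++ w ∈ lang X ∧ follower X (q ++ w) = F'.words := by
  induction w generalizing F q with
  | nil =>
    rw [reads_nil, List.append_nil, hq, FischerNode.ext_iff]
    exact ⟨fun h => ⟨mem_lang_of_follower_eq hX hq, h⟩, fun h => h.2⟩
  | cons d w ih =>
    rw [reads_cons, List.append_cons]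
    constructor
    · rintro ⟨F₁, he, h⟩
      exact (ih ((isFischerEdge_iff hX hq).1 he).2).1 h
    · intro h
      have hqd := mem_lang_of_append_left h.1
      obtain ⟨F₁, hF₁⟩ := exists_node_of_append_mem_lang hX hq hqd
      exact ⟨F₁, (isFischerEdge_iff hX hq).2 ⟨hqd, hF₁⟩, (ih hF₁).2 h⟩

theorem exists_reads_iff (hX : IsSubshift X) {F : FischerNode X} {w : List (Fin g)} :
    (∃ F', NodeReads F w F') ↔ w ∈ F.words := by
  obtain ⟨q, _, hq⟩ := F.exists_follower_eq
  simp only [reads_iff hX hq]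
  rw [← hq, mem_follower hX]
  exact ⟨fun ⟨_, h, _⟩ => h, fun h =>
    (exists_node_of_append_mem_lang hX hq h).imp fun F' hF' => ⟨h, hF'⟩⟩

theorem reads_unique (hX : IsSubshift X) {F F₁ F₂ : FischerNode X} {w : List (Fin g)}
    (h₁ : NodeReads F w F₁) (h₂ : NodeReads F w F₂) : F₁ = F₂ := by
  obtain ⟨q, _, hq⟩ := F.exists_follower_eq
  rw [reads_iff hX hq] at h₁ h₂
  exact FischerNode.ext (h₁.2.symm.trans h₂.2)

theorem mem_of_reads (hX : IsSubshift X) {F F' : FischerNode X} {u : List (Fin g)}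
    (h : NodeReads F u F') (v : List (Fin g)) : v ∈ F'.words ↔ u ++ v ∈ F.words := by
  obtain ⟨q, _, hq⟩ := F.exists_follower_eq
  rw [← ((reads_iff hX hq).1 h).2, ← hq, mem_follower_append hX]

theorem FischerNode.mem_lang {F : FischerNode X} {w : List (Fin g)} (h : w ∈ F.words) :
    w ∈ lang X := by
  obtain ⟨q, _, hq⟩ := F.exists_follower_eq
  rw [← hq] at h
  exact h.1

theorem isFischerEdge_unique (hX : IsSubshift X) {F F₁ F₂ : FischerNode X} {d : Fin g}
    (h₁ : IsFischerEdge F d F₁) (h₂ : IsFischerEdge F d F₂) : F₁ = F₂ := by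
  obtain ⟨q, _, hq⟩ := F.exists_follower_eq
  rw [isFischerEdge_iff hX hq] at h₁ h₂
  exact FischerNode.ext (h₁.2.symm.trans h₂.2)

/-! ### Counting words in a regular Fischer cover -/

variable [IsSofic X] {k : ℕ}

theorem sum_edges_out (hreg : (fischerCover X).IsRegular k) (F : FischerNode X) :
    ∑ d, ∑ F', ind (IsFischerEdge F d F') = k := by
  rw [← (hreg F).1, ← Fintype.sum_prod_type', sum_ind_eq_natCard]
  refine congrArg Nat.cast (Nat.card_congr
    ⟨fun x => ⟨⟨(F, x.1), x.2⟩, rfl⟩, fun e => ⟨e.1.1.2, ?_⟩, fun x => rfl, ?_⟩)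
  · have h := e.1.2
    rwa [show e.1.1.1 = F from e.2] at h
  · rintro ⟨⟨⟨F₀, d, F'⟩, he⟩, rfl⟩
    rfl

theorem sum_edges_in (hreg : (fischerCover X).IsRegular k) (F' : FischerNode X) :
    ∑ d, ∑ F, ind (IsFischerEdge F d F') = k := by
  rw [← (hreg F').2, ← Fintype.sum_prod_type', sum_ind_eq_natCard]
  refine congrArg Nat.cast (Nat.card_congr
    ⟨fun x => ⟨⟨(x.1.2, x.1.1, F'), x.2⟩, rfl⟩, fun e => ⟨(e.1.1.2.1, e.1.1.1), ?_⟩,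
      fun x => rfl, ?_⟩)
  · have h := e.1.2
    rwa [show e.1.1.2.2 = F' from e.2] at h
  · rintro ⟨⟨⟨F₀, d, F'⟩, he⟩, rfl⟩
    rfl

theorem wordSum_reads_succ (hX : IsSubshift X) (n : ℕ) (F F' : FischerNode X) :
    wordSum (n + 1) (fun w => ind (NodeReads F w F')) =
      ∑ d, ∑ F₁, ind (IsFischerEdge F d F₁) *
        wordSum n (fun w => ind (NodeReads F₁ w F')) := by
  refine Finset.sum_congr rfl fun d _ => ?_
  simp only [reads_cons, ← wordSum_mul_left, ← ind_and]
  rw [← wordSum_sum]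
  exact wordSum_congr fun w _ =>
    (sum_ind_of_unique fun _ _ h₁ h₂ => isFischerEdge_unique hX h₁.1 h₂.1).symm

theorem sum_wordSum_reads_out (hX : IsSubshift X) (hreg : (fischerCover X).IsRegular k)
    (n : ℕ) (F : FischerNode X) :
    ∑ F', wordSum n (fun w => ind (NodeReads F w F')) = (k : ℝ) ^ n := by
  induction n generalizing F with
  | zero =>
    simp only [wordSum, reads_nil, pow_zero]
    rw [sum_ind_of_unique (by rintro _ _ rfl rfl; rfl), ind_of ⟨F, rfl⟩]
  | succ n ih =>
    simp only [wordSum_reads_succ hX]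
    rw [Finset.sum_comm]
    simp only [Finset.sum_comm (f := fun F' F₁ => ind (IsFischerEdge F _ F₁) * _),
      ← Finset.mul_sum, ih]
    simp only [← Finset.sum_mul]
    rw [Finset.sum_comm, sum_edges_out hreg F, pow_succ']

/-- Pairs of a source node and a word are counted, not words: one word may lead to `F'` from several
nodes. -/
theorem sum_wordSum_reads_in (hX : IsSubshift X) (hreg : (fischerCover X).IsRegular k)
    (n : ℕ) (F' : FischerNode X) :
    ∑ F, wordSum n (fun w => ind (NodeReads F w F')) = (k : ℝ) ^ n := by
  induction n with
  | zero =>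
    simp only [wordSum, reads_nil, pow_zero]
    rw [sum_ind_of_unique (by rintro _ _ rfl rfl; rfl), ind_of ⟨F', rfl⟩]
  | succ n ih =>
    simp only [wordSum_reads_succ hX]
    have h : ∀ F, ∑ d, ∑ F₁, ind (IsFischerEdge F d F₁) *
        wordSum n (fun w => ind (NodeReads F₁ w F')) =
        ∑ F₁, ∑ d, ind (IsFischerEdge F d F₁) *
          wordSum n (fun w => ind (NodeReads F₁ w F')) := fun F => Finset.sum_comm
    simp only [h]
    rw [Finset.sum_comm, pow_succ', ← ih, Finset.mul_sum]
    refine Finset.sum_congr rfl fun F₁ _ => ?_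
    rw [Finset.sum_comm, ← sum_edges_in hreg F₁]
    simp only [Finset.sum_mul]

theorem wordSum_mem_node (hX : IsSubshift X) (hreg : (fischerCover X).IsRegular k)
    (n : ℕ) (F : FischerNode X) : wordSum n (fun w => ind (w ∈ F.words)) = (k : ℝ) ^ n := by
  rw [← sum_wordSum_reads_out hX hreg n F, ← wordSum_sum]
  refine wordSum_congr fun w _ => ?_
  rw [sum_ind_of_unique fun _ _ => reads_unique hX, exists_reads_iff hX]

omit [IsSofic X] in
/-- In a mixing shift with a synchronizing word, every word is read from some node. -/
theorem exists_node_mem (hX : IsSubshift X) (hmix : IsMixing X) {s : List (Fin g)}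
    (hs : IsSynchronizing X s) {w : List (Fin g)} (hw : w ∈ lang X) :
    ∃ F : FischerNode X, w ∈ F.words := by
  obtain ⟨n, hn⟩ := hmix s hs.1 w hw
  obtain ⟨x, _, _, hx⟩ := hn n le_rfl
  have hsx := mem_lang_of_append_left hx
  exact ⟨FischerNode.ofWord (hs.append_right hX hsx), (mem_follower hX).2 hx⟩

theorem wordSum_lang_and_le (hX : IsSubshift X) (hmix : IsMixing X) {s : List (Fin g)}
    (hs : IsSynchronizing X s) (n : ℕ) {P : List (Fin g) → Prop} {c : ℝ}
    (hc : ∀ F : FischerNode X, wordSum n (fun w => ind (w ∈ F.words ∧ P w)) ≤ c) :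
    wordSum n (fun w => ind (w ∈ lang X ∧ P w)) ≤ Fintype.card (FischerNode X) * c := by
  calc wordSum n (fun w => ind (w ∈ lang X ∧ P w))
      ≤ wordSum n (fun w => ∑ F : FischerNode X, ind (w ∈ F.words ∧ P w)) := by
        refine wordSum_mono fun w _ => le_trans (ind_mono ?_) (ind_exists_le_sum _)
        exact fun h => (exists_node_mem hX hmix hs h.1).imp fun F hF => ⟨hF, h.2⟩
    _ = ∑ F : FischerNode X, wordSum n (fun w => ind (w ∈ F.words ∧ P w)) := wordSum_sum _ _ _
    _ ≤ ∑ _F : FischerNode X, c := Finset.sum_le_sum fun F _ => hc F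
    _ = Fintype.card (FischerNode X) * c := by simp

theorem wordSum_lang_le (hX : IsSubshift X) (hmix : IsMixing X) {s : List (Fin g)}
    (hs : IsSynchronizing X s) (hreg : (fischerCover X).IsRegular k) (n : ℕ) :
    wordSum n (fun w => ind (w ∈ lang X)) ≤ Fintype.card (FischerNode X) * (k : ℝ) ^ n := by
  have h := wordSum_lang_and_le (P := fun _ => True) hX hmix hs n
    fun F => by simpa using (wordSum_mem_node hX hreg n F).le
  simpa using h

/-! ### Words that are not synchronizing are rare -/

/-- Mixing allows every large gap length, hence one length common to the finitely many nodes. -/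
theorem exists_append_mem_node (hmix : IsMixing X) (hX : IsSubshift X) {s : List (Fin g)}
    (hs : IsSynchronizing X s) :
    ∃ m, ∀ F : FischerNode X, ∃ x, x.length = m ∧ x ++ s ∈ F.words := by
  have h : ∀ F : FischerNode X, ∃ n, ∀ m ≥ n, ∃ x, x.length = m ∧ x ++ s ∈ F.words := by
    intro F
    obtain ⟨q, hq, hF⟩ := F.exists_follower_eq
    obtain ⟨n, hn⟩ := hmix q hq.1 s hs.1
    refine ⟨n, fun m hm => ?_⟩
    obtain ⟨x, _, hxm, hx⟩ := hn m hm
    refine ⟨x, hxm, ?_⟩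
    rwa [← hF, mem_follower hX, ← List.append_assoc]
  choose n hn using h
  exact ⟨∑ F, n F, fun F => hn F _
    (Finset.single_le_sum (f := n) (fun _ _ => Nat.zero_le _) (Finset.mem_univ F))⟩

/-- Whatever node has been reached, at least one of the `k ^ M` possible next blocks of length `M`
is synchronizing, and using it once makes the whole word synchronizing. At most `k ^ M - 1` choices
per block remain. -/
theorem wordSum_not_synchronizing_le (hX : IsSubshift X) (hreg : (fischerCover X).IsRegular k)
    {M : ℕ} (hM : ∀ F : FischerNode X, ∃ y, y.length = M ∧ y ∈ F.words ∧ IsSynchronizing X y)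
    (n : ℕ) (F : FischerNode X) :
    wordSum (M * n) (fun w => ind (w ∈ F.words ∧ ¬IsSynchronizing X w)) ≤ ((k : ℝ) ^ M - 1) ^ n := by
  have hstep : ∀ F : FischerNode X,
      wordSum M (fun w => ind (w ∈ F.words ∧ ¬IsSynchronizing X w)) ≤ (k : ℝ) ^ M - 1 := by
    intro F
    obtain ⟨y, rfl, hyF, hy⟩ := hM F
    have h₁ : 1 ≤ wordSum y.length (fun w => ind (w ∈ F.words ∧ IsSynchronizing X w)) := by
      rw [← wordSum_ind_eq y]
      exact wordSum_mono fun w _ => ind_mono (by rintro rfl; exact ⟨hyF, hy⟩)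
    have h₂ := wordSum_mem_node hX hreg y.length F
    simp only [← fun w => ind_and_add_ind_and_not (w ∈ F.words) (IsSynchronizing X w),
      wordSum_add] at h₂
    linarith
  have hnn : 0 ≤ (k : ℝ) ^ M - 1 := (wordSum_nonneg fun w => ind_nonneg _).trans (hstep F)
  induction n generalizing F with
  | zero => exact ind_le_one _
  | succ n ih =>
    rw [Nat.mul_succ, add_comm, wordSum_append, pow_succ']
    calc wordSum M (fun u => wordSum (M * n)
          fun v => ind (u ++ v ∈ F.words ∧ ¬IsSynchronizing X (u ++ v)))
        ≤ wordSum M (fun u => ind (u ∈ F.words ∧ ¬IsSynchronizing X u) * ((k : ℝ) ^ M - 1) ^ n) := by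
          refine wordSum_mono fun u _ => ?_
          by_cases hu : u ∈ F.words ∧ ¬IsSynchronizing X u
          · obtain ⟨F₁, hF₁⟩ := (exists_reads_iff hX).2 hu.1
            rw [ind_of hu, one_mul]
            refine le_trans (wordSum_mono fun v _ => ind_mono ?_) (ih F₁)
            rintro ⟨h₁, h₂⟩
            exact ⟨(mem_of_reads hX hF₁ v).2 h₁,
              fun h => h₂ (h.append_left hX (FischerNode.mem_lang h₁))⟩
          · rw [ind_of_not hu, zero_mul]
            refine (le_of_eq (wordSum_congr (ψ := fun _ => (0 : ℝ) * 0) fun v _ => ?_)).trans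
              (by rw [wordSum_mul_left, zero_mul])
            rw [mul_zero]
            refine ind_of_not fun ⟨h₁, h₂⟩ => hu ⟨?_, fun h =>
              h₂ (h.append_right hX (FischerNode.mem_lang h₁))⟩
            obtain ⟨q, _, hq⟩ := F.exists_follower_eq
            rw [← hq, mem_follower hX] at h₁ ⊢
            rw [← List.append_assoc] at h₁
            exact mem_lang_of_append_left h₁
      _ = wordSum M (fun u => ind (u ∈ F.words ∧ ¬IsSynchronizing X u)) * ((k : ℝ) ^ M - 1) ^ n :=
          wordSum_mul_right _ _ _
      _ ≤ ((k : ℝ) ^ M - 1) * ((k : ℝ) ^ M - 1) ^ n :=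
          mul_le_mul_of_nonneg_right (hstep F) (pow_nonneg hnn n)

end Words

/-! ### Additive functions and residues -/

section Additive

variable {g : ℕ}

theorem IsAdditiveBase.map_zero {f : ℕ → ℤ} (hf : IsAdditiveBase g f) (hg : 0 < g) : f 0 = 0 := by
  -- Two zero digits give `f 0 = f 0 + f 0`; a single digit would give a tautology.
  have := hf 1 (fun _ => 0) fun _ => hg
  simp at this
  omega

theorem IsAdditiveBase.eq_sum_digits {f : ℕ → ℤ} (hf : IsAdditiveBase g f) (hg : 0 < g) {n m : ℕ}
    (h : n < g ^ (m + 1)) : f n = ∑ i ∈ Finset.range (m + 1), f (n / g ^ i % g * g ^ i) := by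
  have key : ∀ m, ∑ i ∈ Finset.range m, n / g ^ i % g * g ^ i = n % g ^ m := by
    intro m
    induction m with
    | zero => simp [Nat.mod_one]
    | succ m ih => rw [Finset.sum_range_succ, ih, Nat.mod_pow_succ, mul_comm]
  rw [← hf m _ fun i => Nat.mod_lt _ hg, key, Nat.mod_eq_of_lt h]

/-- The digits of `x` lie below position `j`, those of `g ^ j * y` at or above it. All three numbers
are expanded over one common range, the absent digits contributing `f 0 = 0`. -/
theorem IsAdditiveBase.map_add_pow_mul {f : ℕ → ℤ} (hf : IsAdditiveBase g f) (hg : 2 ≤ g)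
    {x j : ℕ} (hx : x < g ^ j) (y : ℕ) : f (x + g ^ j * y) = f x + f (g ^ j * y) := by
  have hg0 : 0 < g := by omega
  have hlt : x + g ^ j * y < g ^ (x + g ^ j * y + 1) :=
    (Nat.lt_succ_self _).trans (Nat.lt_pow_self (by omega))
  rw [hf.eq_sum_digits hg0 hlt, hf.eq_sum_digits (n := x) hg0 (lt_of_le_of_lt (by omega) hlt),
    hf.eq_sum_digits (n := g ^ j * y) hg0 (lt_of_le_of_lt (by omega) hlt),
    ← Finset.sum_add_distrib]
  refine Finset.sum_congr rfl fun i _ => ?_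
  have hi : 0 < g ^ i := pow_pos hg0 i
  rcases lt_or_ge i j with hij | hij
  · obtain ⟨c, rfl⟩ := Nat.exists_eq_add_of_lt hij
    have h : g ^ (i + c + 1) * y = g ^ i * (g * (g ^ c * y)) := by ring
    rw [h, Nat.add_mul_div_left _ _ hi, Nat.mul_div_cancel_left _ hi, Nat.add_mul_mod_self_left,
      Nat.mul_mod_right, Nat.zero_mul, hf.map_zero hg0, add_zero]
  · obtain ⟨c, rfl⟩ := Nat.exists_eq_add_of_le hij
    have hj : 0 < g ^ j := pow_pos hg0 j
    rw [pow_add, ← Nat.div_div_eq_div_mul, ← Nat.div_div_eq_div_mul, ← Nat.div_div_eq_div_mul,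
      Nat.add_mul_div_left _ _ hj, Nat.div_eq_of_lt hx, Nat.mul_div_cancel_left _ hj, zero_add,
      Nat.zero_div, Nat.zero_mod, Nat.zero_mul, hf.map_zero hg0, zero_add]

theorem wordValue_append (u v : List (Fin g)) :
    wordValue (u ++ v) = wordValue u + g ^ u.length * wordValue v := by
  simp [wordValue, Nat.ofDigits_append]

theorem wordValue_cons (d : Fin g) (w : List (Fin g)) :
    wordValue (d :: w) = d + g * wordValue w := by
  simp [wordValue, Nat.ofDigits_cons]

theorem wordValue_nil : wordValue ([] : List (Fin g)) = 0 := rfl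

theorem wordValue_lt (w : List (Fin g)) : wordValue w < g ^ w.length := by
  induction w with
  | nil => simp [wordValue_nil]
  | cons d w ih =>
    have h : g * wordValue w + g ≤ g * g ^ w.length := by
      rw [← Nat.mul_succ]; exact Nat.mul_le_mul_left g ih
    rw [wordValue_cons, List.length_cons, pow_succ']
    have := d.2
    omega

end Additive

section Residues

variable {g r : ℕ} (f : Fin r → ℕ → ℤ) (a : Fin r → ℕ)

/-- The residues of the values `f j n` modulo the `a j`. -/
def residue (n : ℕ) (j : Fin r) : ZMod (a j) := (f j n : ZMod (a j))

variable {f a}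

theorem congrMod_iff {n : ℕ} {b : ∀ j, ZMod (a j)} : CongrMod f a n b ↔ residue f a n = b :=
  funext_iff.symm

theorem residue_zero (hg : 2 ≤ g) (hf : ∀ j, IsAdditiveBase g (f j)) : residue f a 0 = 0 := by
  ext j
  simp [residue, (hf j).map_zero (show 0 < g by omega)]

theorem residue_add_pow_mul (hg : 2 ≤ g) (hf : ∀ j, IsAdditiveBase g (f j)) {x i : ℕ}
    (hx : x < g ^ i) (y : ℕ) :
    residue f a (x + g ^ i * y) = residue f a x + residue f a (g ^ i * y) := by
  ext j
  simp only [residue, (hf j).map_add_pow_mul hg hx y, Pi.add_apply, Int.cast_add]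

theorem residue_append (hg : 2 ≤ g) (hf : ∀ j, IsAdditiveBase g (f j)) (i : ℕ)
    (u v : List (Fin g)) :
    residue f a (g ^ i * wordValue (u ++ v)) =
      residue f a (g ^ i * wordValue u) + residue f a (g ^ (i + u.length) * wordValue v) := by
  rw [wordValue_append, mul_add, ← mul_assoc, ← pow_add]
  refine residue_add_pow_mul hg hf ?_ _
  rw [pow_add]
  exact Nat.mul_lt_mul_of_pos_left (wordValue_lt u) (pow_pos (by omega) i)

/-- Periodicity is assumed for single digits only; additivity extends it to words. -/
theorem residue_period (hg : 2 ≤ g) (hf : ∀ j, IsAdditiveBase g (f j)) {p l : ℕ}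
    (hper : IsEventualPeriod g f a p l) {i : ℕ} (hi : l ≤ i) (w : List (Fin g)) :
    residue f a (g ^ (i + p) * wordValue w) = residue f a (g ^ i * wordValue w) := by
  induction w generalizing i with
  | nil => simp [wordValue_nil]
  | cons d w ih =>
    rw [← List.singleton_append, residue_append hg hf, residue_append hg hf, List.length_singleton,
      add_right_comm, ih (by omega)]
    congr 1
    ext j
    have h := hper.2 d d.2 1 le_rfl i hi j
    rw [← ZMod.intCast_eq_intCast_iff, one_mul] at h
    simpa [residue, wordValue_cons, wordValue_nil, mul_comm] using h

end Residues

/-! ### Walks on the state space and powers of the transition matrices -/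

section Walks

variable {g r : ℕ} {X : Set (ℕ → Fin g)} {f : Fin r → ℕ → ℤ} {a : Fin r → ℕ}

/-- Reading the word `w` from position `i` on leads from the state `s` to the state `s'`. -/
def IsWalk (f : Fin r → ℕ → ℤ) (i : ℕ) (s : State X a) (w : List (Fin g)) (s' : State X a) :
    Prop :=
  s.1 + residue f a (g ^ i * wordValue w) = s'.1 ∧ NodeReads s.2 w s'.2

theorem isWalk_nil (hg : 2 ≤ g) (hf : ∀ j, IsAdditiveBase g (f j)) {i : ℕ} {s s' : State X a} :
    IsWalk f i s [] s' ↔ s = s' := by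
  rw [IsWalk, reads_nil, wordValue_nil, mul_zero, residue_zero hg hf, add_zero, Prod.ext_iff]

theorem isWalk_unique (hX : IsSubshift X) {i : ℕ} {s s₁ s₂ : State X a} {w : List (Fin g)}
    (h₁ : IsWalk f i s w s₁) (h₂ : IsWalk f i s w s₂) : s₁ = s₂ :=
  Prod.ext (h₁.1.symm.trans h₂.1) (reads_unique hX h₁.2 h₂.2)

theorem isWalk_append (hg : 2 ≤ g) (hf : ∀ j, IsAdditiveBase g (f j)) {i : ℕ}
    {s s' : State X a} {u v : List (Fin g)} :
    IsWalk f i s (u ++ v) s' ↔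
      ∃ s₁, IsWalk f i s u s₁ ∧ IsWalk f (i + u.length) s₁ v s' := by
  simp only [IsWalk, reads_append, residue_append hg hf]
  constructor
  · rintro ⟨h, F₁, h₁, h₂⟩
    exact ⟨(_, F₁), ⟨rfl, h₁⟩, by rw [add_assoc, h], h₂⟩
  · rintro ⟨s₁, ⟨h₁, h₂⟩, h₃, h₄⟩
    exact ⟨by rw [← add_assoc, h₁, h₃], s₁.2, h₂, h₄⟩

theorem isWalk_period (hg : 2 ≤ g) (hf : ∀ j, IsAdditiveBase g (f j)) {p l : ℕ}
    (hper : IsEventualPeriod g f a p l) {i : ℕ} (hi : l ≤ i) {s s' : State X a}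
    {w : List (Fin g)} : IsWalk f (i + p) s w s' ↔ IsWalk f i s w s' := by
  rw [IsWalk, IsWalk, residue_period hg hf hper hi]

theorem transitionMatrix_apply (hX : IsSubshift X) (k p i : ℕ) (s s' : State X a) :
    transitionMatrix X f a k p i s s' =
      ((k : ℝ) ^ p)⁻¹ * wordSum p fun w => ind (IsWalk f i s w s') := by
  rw [transitionMatrix, ← wordSum_ind_mem fun w hw => hw.2.1]
  congr 1
  refine wordSum_congr fun w hw => congrArg ind (propext ?_)
  simp only [extensionSet, Set.mem_ofPred_eq, congrMod_iff, IsWalk]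
  constructor
  · rintro ⟨_, _, h₁, h₂⟩
    exact ⟨by rw [h₁]; abel, h₂⟩
  · rintro ⟨h₁, h₂⟩
    exact ⟨FischerNode.mem_lang ((exists_reads_iff hX).1 ⟨_, h₂⟩), hw,
      by rw [← h₁]; abel, h₂⟩

variable [IsSofic X] [∀ j, NeZero (a j)] {k : ℕ}

/-- Given the source node and the word, exactly one source residue leads to `s'.1`. Residues thus
drop out, leaving the `k ^ p` incoming paths. -/
theorem transitionMatrix_col_sum (hX : IsSubshift X) (hk : k ≠ 0)
    (hreg : (fischerCover X).IsRegular k) (p i : ℕ) (s' : State X a) :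
    ∑ s, transitionMatrix X f a k p i s s' = 1 := by
  have h : ∀ F : FischerNode X, ∑ b, wordSum p (fun w => ind (IsWalk f i (b, F) w s')) =
      wordSum p (fun w => ind (NodeReads F w s'.2)) := by
    intro F
    rw [← wordSum_sum]
    refine wordSum_congr fun w _ => ?_
    rw [sum_ind_of_unique fun _ _ h₁ h₂ => add_right_cancel (h₁.1.trans h₂.1.symm)]
    exact congrArg ind (propext ⟨fun ⟨_, h⟩ => h.2,
      fun h => ⟨s'.1 - residue f a (g ^ i * wordValue w), sub_add_cancel _ _, h⟩⟩)
  simp only [transitionMatrix_apply hX]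
  rw [← Finset.mul_sum, Fintype.sum_prod_type_right]
  simp only [h]
  rw [sum_wordSum_reads_in hX hreg]
  exact inv_mul_cancel₀ (pow_ne_zero p (Nat.cast_ne_zero.2 hk))

/-- Successive blocks are read from positions `i`, `i + p`, `i + 2p`, and so on; since `i ≥ l`,
periodicity lets the same matrix serve for all of them. -/
theorem transitionMatrix_pow_apply [DecidableEq (State X a)] (hg : 2 ≤ g)
    (hf : ∀ j, IsAdditiveBase g (f j)) (hX : IsSubshift X) {p l : ℕ}
    (hper : IsEventualPeriod g f a p l) {i : ℕ} (hi : l ≤ i) (m : ℕ) (s s' : State X a) :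
    (transitionMatrix X f a k p i ^ m) s s' =
      ((k : ℝ) ^ (p * m))⁻¹ * wordSum (p * m) fun w => ind (IsWalk f i s w s') := by
  induction m generalizing s with
  | zero =>
    simp only [mul_zero, pow_zero, wordSum, isWalk_nil hg hf, Matrix.one_apply, ind, inv_one,
      one_mul]
  | succ m ih =>
    rw [pow_succ', Matrix.mul_apply]
    simp only [ih, transitionMatrix_apply hX]
    rw [Nat.mul_succ, add_comm (p * m), pow_add, mul_inv, wordSum_append]
    have h : ∀ u : List (Fin g), u.length = p → ∀ v,
        ind (IsWalk f i s (u ++ v) s') =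
          ∑ s₁, ind (IsWalk f i s u s₁) * ind (IsWalk f i s₁ v s') := by
      intro u hu v
      simp only [isWalk_append hg hf, hu, isWalk_period hg hf hper hi, ← ind_and]
      rw [sum_ind_of_unique fun _ _ h₁ h₂ => isWalk_unique hX h₁.1 h₂.1]
    rw [wordSum_congr fun u hu => wordSum_congr fun v _ => h u hu v]
    simp only [wordSum_sum, wordSum_mul_left, wordSum_mul_right]
    rw [Finset.mul_sum]
    exact Finset.sum_congr rfl fun s₁ _ => by ring

end Walks

/-! ### Equidistribution of residues over prefixes of a fixed length. -/

section Equidistribution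

variable {g r : ℕ} {X : Set (ℕ → Fin g)} {f : Fin r → ℕ → ℤ} {a : Fin r → ℕ}

/-- The number of words `u` of length `n` such that `u t` is in the language and the value of `u`
has residue `b`. -/
noncomputable def prefixCount (X : Set (ℕ → Fin g)) (f : Fin r → ℕ → ℤ) (a : Fin r → ℕ) (n : ℕ)
    (t : List (Fin g)) (b : ∀ j, ZMod (a j)) : ℝ :=
  wordSum n fun u => ind (u ++ t ∈ lang X ∧ residue f a (wordValue u) = b)

/-- A synchronizing `q` determines a starting state, and that state retains all that matters about
`q`: its residue and its possible continuations. -/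
theorem exists_isWalk_iff (hg : 2 ≤ g) (hf : ∀ j, IsAdditiveBase g (f j)) (hX : IsSubshift X)
    {q : List (Fin g)} (hq : IsSynchronizing X q) (v t : List (Fin g)) (b : ∀ j, ZMod (a j)) :
    (∃ F' : FischerNode X, t ∈ F'.words ∧
      IsWalk f q.length (residue f a (wordValue q), FischerNode.ofWord hq) v (b, F')) ↔
      q ++ v ++ t ∈ lang X ∧ residue f a (wordValue (q ++ v)) = b := by
  have hres := residue_append (a := a) hg hf 0 q v
  simp only [pow_zero, one_mul, zero_add] at hres
  have hw : ∀ v, v ∈ (FischerNode.ofWord hq).words ↔ q ++ v ∈ lang X := fun v => mem_follower hX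
  rw [hres]
  constructor
  · rintro ⟨F', ht, hb, hF'⟩
    rw [mem_of_reads hX hF', hw, ← List.append_assoc] at ht
    exact ⟨ht, hb⟩
  · rintro ⟨ht, hb⟩
    obtain ⟨F', hF'⟩ := (exists_reads_iff hX).2 ((hw v).2 (mem_lang_of_append_left ht))
    refine ⟨F', ?_, hb, hF'⟩
    rwa [mem_of_reads hX hF', hw, ← List.append_assoc]

variable [IsSofic X]

theorem wordSum_extension_eq (hg : 2 ≤ g) (hf : ∀ j, IsAdditiveBase g (f j)) (hX : IsSubshift X)
    {q : List (Fin g)} (hq : IsSynchronizing X q) (n : ℕ) (t : List (Fin g))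
    (b : ∀ j, ZMod (a j)) :
    (wordSum n fun v => ind (q ++ v ++ t ∈ lang X ∧ residue f a (wordValue (q ++ v)) = b)) =
      ∑ F' : FischerNode X, ind (t ∈ F'.words) * wordSum n fun v =>
        ind (IsWalk f q.length (residue f a (wordValue q), FischerNode.ofWord hq) v (b, F')) := by
  simp only [← wordSum_mul_left, ← ind_and]
  rw [← wordSum_sum]
  refine wordSum_congr fun v _ => ?_
  rw [← exists_isWalk_iff hg hf hX hq,
    sum_ind_of_unique fun _ _ h₁ h₂ => reads_unique hX h₁.2.2 h₂.2.2]

variable [∀ j, NeZero (a j)] {k : ℕ}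

/-- The end states `(b, F')` and `(b', F')` are compared in one row of the power, for each node `F'`
that can read `t`; there are at most `|V|` of them. -/
theorem wordSum_extension_le [DecidableEq (State X a)] (hg : 2 ≤ g)
    (hf : ∀ j, IsAdditiveBase g (f j)) (hX : IsSubshift X) (hk : k ≠ 0) {p l : ℕ}
    (hper : IsEventualPeriod g f a p l) {q : List (Fin g)} (hq : IsSynchronizing X q)
    (hql : l ≤ q.length) {m : ℕ} {δ : ℝ} (hδ : 0 ≤ δ)
    (hm : ∀ s s₁ s₂, (transitionMatrix X f a k p q.length ^ m) s s₁ ≤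
      (transitionMatrix X f a k p q.length ^ m) s s₂ + δ)
    (t : List (Fin g)) (b b' : ∀ j, ZMod (a j)) :
    (wordSum (p * m) fun v =>
        ind (q ++ v ++ t ∈ lang X ∧ residue f a (wordValue (q ++ v)) = b)) ≤
      (wordSum (p * m) fun v =>
        ind (q ++ v ++ t ∈ lang X ∧ residue f a (wordValue (q ++ v)) = b')) +
      Fintype.card (FischerNode X) * (δ * (k : ℝ) ^ (p * m)) := by
  have hk0 : (0 : ℝ) < (k : ℝ) ^ (p * m) := by positivity
  rw [wordSum_extension_eq hg hf hX hq, wordSum_extension_eq hg hf hX hq, ← nsmul_eq_mul,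
    ← Finset.card_univ, ← Finset.sum_const, ← Finset.sum_add_distrib]
  refine Finset.sum_le_sum fun F' _ => ?_
  have h := hm (residue f a (wordValue q), FischerNode.ofWord hq) (b, F') (b', F')
  rw [transitionMatrix_pow_apply hg hf hX hper hql, transitionMatrix_pow_apply hg hf hX hper hql]
    at h
  have h' := mul_le_mul_of_nonneg_left h hk0.le
  rw [mul_add, mul_inv_cancel_left₀ hk0.ne', mul_inv_cancel_left₀ hk0.ne'] at h'
  have hi := ind_nonneg (t ∈ F'.words)
  have hi' := ind_le_one (t ∈ F'.words)
  nlinarith [mul_le_mul_of_nonneg_left h' hi, mul_le_mul_of_nonneg_right hi' (mul_nonneg hk0.le hδ)]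

/-- The length is `T + p * m`: `T` makes non-synchronizing prefixes rare, and `m`, chosen afterwards
because the matrix depends on `T`, mixes the residues. Uniformity in `t` is what lets one length
serve all blocks of integers. -/
theorem exists_prefixCount_le (hg : 2 ≤ g) (hf : ∀ j, IsAdditiveBase g (f j))
    (hX : IsSubshift X) (hmix : IsMixing X) (hk : 2 ≤ k) (hreg : (fischerCover X).IsRegular k)
    {p l : ℕ} (hper : IsEventualPeriod g f a p l)
    (hsync : ∃ w, IsSynchronizing X w ∧ w.length = l)
    (hMarkov : MarkovCondition X f a k p l) {δ : ℝ} (hδ : 0 < δ) :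
    ∃ n, ∀ t b b', prefixCount X f a n t b ≤ prefixCount X f a n t b' + δ * (k : ℝ) ^ n := by
  classical
  obtain ⟨s, hs, rfl⟩ := hsync
  have hk0 : (0 : ℝ) < k := by positivity
  set C : ℝ := (Fintype.card (FischerNode X) : ℝ)
  have hC : 0 ≤ C := Nat.cast_nonneg _
  -- Synchronizing and non-synchronizing prefixes each cost at most `C * C * δ'` times `k ^ (T + p *
  -- m)`.
  obtain ⟨δ', hδ', hδC⟩ : ∃ δ' > 0, C * C * (2 * δ') ≤ δ := by
    refine ⟨δ / (2 * (C * C + 1)), by positivity, ?_⟩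
    rw [mul_div_assoc', mul_div_assoc', div_le_iff₀ (by positivity)]
    nlinarith
  obtain ⟨m₀, hm₀⟩ := exists_append_mem_node hmix hX hs
  set M := m₀ + s.length
  have hM : ∀ F : FischerNode X, ∃ y, y.length = M ∧ y ∈ F.words ∧ IsSynchronizing X y := by
    intro F
    obtain ⟨x, hx, hxs⟩ := hm₀ F
    exact ⟨x ++ s, by rw [List.length_append, hx], hxs,
      hs.append_left hX (FischerNode.mem_lang hxs)⟩
  have hkM : (0 : ℝ) < (k : ℝ) ^ M := by positivity
  have hkM1 : (1 : ℝ) ≤ (k : ℝ) ^ M := one_le_pow₀ (by exact_mod_cast (by omega : 1 ≤ k))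
  -- The exponent `n + 1` guarantees `T ≥ M ≥ s.length`, so position `T` is in the periodic range.
  obtain ⟨n, hn⟩ : ∃ n, ((k : ℝ) ^ M - 1) ^ (n + 1) ≤ δ' * (k : ℝ) ^ (M * (n + 1)) := by
    obtain ⟨n, hn⟩ := exists_pow_lt_of_lt_one hδ'
      (show ((k : ℝ) ^ M - 1) / (k : ℝ) ^ M < 1 by rw [div_lt_one hkM]; linarith)
    refine ⟨n, ?_⟩
    rw [pow_mul, ← div_le_iff₀ (by positivity), ← div_pow]
    refine le_trans (pow_le_pow_of_le_one (div_nonneg (by linarith) hkM.le) ?_ (Nat.le_succ n)) hn.le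
    rw [div_le_one hkM]; linarith
  set T := M * (n + 1)
  have hT : s.length ≤ T := (Nat.le_add_left _ _).trans (Nat.le_mul_of_pos_right M n.succ_pos)
  obtain ⟨m, hm⟩ := exists_pow_row_oscillation_le (hMarkov T hT).1
    (M := transitionMatrix X f a k p T) (hMarkov T hT).2
    (transitionMatrix_col_sum hX (by omega) hreg p T) hδ'
  refine ⟨T + p * m, fun t b b' => ?_⟩
  have hkp : (0 : ℝ) < (k : ℝ) ^ (p * m) := by positivity
  rw [prefixCount, prefixCount, wordSum_append, wordSum_append]
  have hpt : ∀ q : List (Fin g), q.length = T →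
      (wordSum (p * m) fun v =>
        ind (q ++ v ++ t ∈ lang X ∧ residue f a (wordValue (q ++ v)) = b)) ≤
      (wordSum (p * m) fun v =>
        ind (q ++ v ++ t ∈ lang X ∧ residue f a (wordValue (q ++ v)) = b')) +
      (ind (q ∈ lang X) * (C * (δ' * (k : ℝ) ^ (p * m))) +
        ind (q ∈ lang X ∧ ¬IsSynchronizing X q) * (C * (k : ℝ) ^ (p * m))) := by
    intro q hqT
    have hnn : 0 ≤ wordSum (p * m) fun v =>
        ind (q ++ v ++ t ∈ lang X ∧ residue f a (wordValue (q ++ v)) = b') :=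
      wordSum_nonneg fun v => ind_nonneg _
    by_cases hq : IsSynchronizing X q
    · rw [ind_of hq.1, ind_of_not fun h => h.2 hq, one_mul, zero_mul, add_zero]
      exact wordSum_extension_le hg hf hX (by omega) hper hq (by omega) hδ'.le
        (by rw [hqT]; exact hm) t b b'
    · by_cases hqL : q ∈ lang X
      · rw [ind_of hqL, ind_of ⟨hqL, hq⟩, one_mul, one_mul]
        have h : (wordSum (p * m) fun v =>
            ind (q ++ v ++ t ∈ lang X ∧ residue f a (wordValue (q ++ v)) = b)) ≤
            C * (k : ℝ) ^ (p * m) :=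
          (wordSum_mono fun v _ => ind_mono fun h =>
            mem_lang_of_append_right hX (mem_lang_of_append_left h.1)).trans
            (wordSum_lang_le hX hmix hs hreg _)
        have h' : 0 ≤ C * (δ' * (k : ℝ) ^ (p * m)) := by positivity
        linarith
      · rw [ind_of_not hqL, ind_of_not fun h => hqL h.1, zero_mul, zero_mul, add_zero, add_zero]
        exact wordSum_mono fun v _ => ind_mono fun h =>
          (hqL (mem_lang_of_append_left (mem_lang_of_append_left h.1))).elim
  refine (wordSum_mono hpt).trans ?_
  rw [wordSum_add, wordSum_add, wordSum_mul_right, wordSum_mul_right]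
  have h₁ := wordSum_lang_le hX hmix hs hreg T
  have h₂ := (wordSum_lang_and_le hX hmix hs T
    (wordSum_not_synchronizing_le hX hreg hM (n + 1))).trans
    (mul_le_mul_of_nonneg_left hn hC)
  have h₃ := mul_le_mul_of_nonneg_right h₁
    (show 0 ≤ C * (δ' * (k : ℝ) ^ (p * m)) by positivity)
  have h₄ := mul_le_mul_of_nonneg_right h₂ (show 0 ≤ C * (k : ℝ) ^ (p * m) by positivity)
  have h₅ := mul_le_mul_of_nonneg_right hδC
    (show 0 ≤ (k : ℝ) ^ T * (k : ℝ) ^ (p * m) by positivity)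
  rw [pow_add]
  linarith

end Equidistribution

/-! ### Canonical words and the language set -/

section Canonical

variable {g : ℕ} {X : Set (ℕ → Fin g)}

theorem sum_range_mul (G m : ℕ) (ψ : ℕ → ℝ) :
    ∑ x ∈ Finset.range (G * m), ψ x =
      ∑ y ∈ Finset.range m, ∑ d ∈ Finset.range G, ψ (G * y + d) := by
  induction m with
  | zero => simp
  | succ m ih => rw [Nat.mul_succ, Finset.sum_range_add, ih, Finset.sum_range_succ]

theorem wordSum_wordValue (n : ℕ) (ψ : ℕ → ℝ) :
    wordSum n (fun w : List (Fin g) => ψ (wordValue w)) = ∑ x ∈ Finset.range (g ^ n), ψ x := by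
  induction n generalizing ψ with
  | zero => simp [wordSum, wordValue_nil]
  | succ n ih =>
    simp only [wordSum, wordValue_cons]
    rw [pow_succ', sum_range_mul, Finset.sum_comm, Finset.sum_range]
    refine Finset.sum_congr rfl fun d _ => ?_
    rw [ih fun y => ψ (d + g * y)]
    simp only [add_comm]

/-- A word is canonical if it is a prefix of every word with the same value. -/
def IsCanonical (t : List (Fin g)) : Prop :=
  ∀ w : List (Fin g), wordValue w = wordValue t → t <+: w

/-- A nonzero value excludes the word `[0]`, which has the value of `[]` without being a prefix of
it. -/
theorem IsCanonical.cons {t : List (Fin g)} (ht : IsCanonical t) {d : Fin g}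
    (h : wordValue (d :: t) ≠ 0) : IsCanonical (d :: t) := by
  intro w hw
  cases w with
  | nil => exact (h hw.symm).elim
  | cons e w =>
    rw [wordValue_cons, wordValue_cons] at hw
    have hg : 0 < g := d.pos
    have h₁ := congrArg (· % g) hw
    have h₂ := congrArg (· / g) hw
    simp only [Nat.add_mul_mod_self_left, Nat.mod_eq_of_lt (Fin.is_lt _)] at h₁
    simp only [Nat.add_mul_div_left _ _ hg, Nat.div_eq_of_lt (Fin.is_lt _), zero_add] at h₂
    rw [Fin.ext h₁, List.cons_prefix_cons]
    exact ⟨rfl, ht w h₂⟩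

theorem IsCanonical.append {t : List (Fin g)} (ht : IsCanonical t) (h : wordValue t ≠ 0)
    (u : List (Fin g)) : IsCanonical (u ++ t) ∧ wordValue (u ++ t) ≠ 0 := by
  induction u with
  | nil => exact ⟨ht, h⟩
  | cons d u ih =>
    have h' : wordValue (d :: (u ++ t)) ≠ 0 := by
      have hg : 0 < g := d.pos
      have := Nat.mul_pos hg (Nat.pos_of_ne_zero ih.2)
      rw [wordValue_cons]
      omega
    exact ⟨ih.1.cons h', h'⟩

theorem exists_isCanonical (hg : 2 ≤ g) (c : ℕ) :
    ∃ t : List (Fin g), IsCanonical t ∧ wordValue t = c := by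
  induction c using Nat.strong_induction_on with
  | _ c ih =>
    rcases Nat.eq_zero_or_pos c with rfl | hc
    · exact ⟨[], fun w _ => List.nil_prefix, wordValue_nil⟩
    · obtain ⟨t, ht, htc⟩ := ih (c / g) (Nat.div_lt_self hc hg)
      have h : wordValue ((⟨c % g, Nat.mod_lt _ (by omega)⟩ : Fin g) :: t) = c := by
        rw [wordValue_cons, htc]
        exact Nat.mod_add_div c g
      exact ⟨_, ht.cons (by rw [h]; exact hc.ne'), h⟩

/-- An integer has many expansions, padded by high zeros; as the language is prefix-closed, testing
the canonical one suffices. -/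
theorem IsCanonical.mem_languageSet_iff {t : List (Fin g)} (ht : IsCanonical t) :
    wordValue t ∈ languageSet X ↔ t ∈ lang X := by
  constructor
  · rintro ⟨w, hw, h⟩
    obtain ⟨z, rfl⟩ := ht w h
    exact mem_lang_of_append_left hw
  · exact fun h => ⟨t, h, rfl⟩

end Canonical

/-! ### Uniform distribution -/

section Counting

variable {g r : ℕ} {X : Set (ℕ → Fin g)} {f : Fin r → ℕ → ℤ} {a : Fin r → ℕ}

/-- The number of `n < N` in the set `A`. -/
noncomputable def countBelow (A : Set ℕ) (N : ℕ) : ℝ := ∑ n ∈ Finset.range N, ind (n ∈ A)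

theorem ncard_inter_Ico (A : Set ℕ) (N : ℕ) :
    ((A ∩ Set.Ico 0 N).ncard : ℝ) = countBelow A N := by
  classical
  have h : A ∩ Set.Ico 0 N = ((Finset.range N).filter (· ∈ A) : Finset ℕ) := by
    ext n
    simp [and_comm]
  rw [h, Set.ncard_coe_finset, Finset.card_eq_sum_ones, Nat.cast_sum, Finset.sum_filter,
    countBelow]
  exact Finset.sum_congr rfl fun x _ => by simp [ind]

theorem countBelow_mono (A : Set ℕ) {M N : ℕ} (h : M ≤ N) : countBelow A M ≤ countBelow A N :=
  Finset.sum_le_sum_of_subset_of_nonneg (Finset.range_subset_range.2 h) fun _ _ _ => ind_nonneg _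

theorem countBelow_add_le (A : Set ℕ) (M R : ℕ) : countBelow A (M + R) ≤ countBelow A M + R := by
  rw [countBelow, Finset.sum_range_add]
  refine add_le_add le_rfl ((Finset.sum_le_sum fun n _ => ind_le_one _).trans ?_)
  simp

theorem countBelow_mul (A : Set ℕ) (G Q : ℕ) :
    countBelow A (G * Q) =
      ∑ c ∈ Finset.range Q, ∑ x ∈ Finset.range G, ind (G * c + x ∈ A) := sum_range_mul G Q _

/-- The elements of the language set with residue `b`. -/
def residueClass (X : Set (ℕ → Fin g)) (f : Fin r → ℕ → ℤ) (a : Fin r → ℕ)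
    (b : ∀ j, ZMod (a j)) : Set ℕ :=
  {n | n ∈ languageSet X ∧ residue f a n = b}

/-- With `wordValue t = 0` the word `u ++ t` could end in zeros and fail to be canonical, so the
block at the origin is excluded. -/
theorem sum_block_language {t : List (Fin g)} (ht : IsCanonical t) (h : wordValue t ≠ 0) (n : ℕ) :
    ∑ x ∈ Finset.range (g ^ n), ind (g ^ n * wordValue t + x ∈ languageSet X) =
      wordSum n fun u => ind (u ++ t ∈ lang X) := by
  rw [← wordSum_wordValue n fun x => ind (g ^ n * wordValue t + x ∈ languageSet X)]
  refine wordSum_congr fun u hu => ?_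
  rw [add_comm, ← hu, ← wordValue_append, (ht.append h u).1.mem_languageSet_iff]

theorem sum_block_residueClass (hg : 2 ≤ g) (hf : ∀ j, IsAdditiveBase g (f j))
    {t : List (Fin g)} (ht : IsCanonical t) (h : wordValue t ≠ 0) (n : ℕ)
    (b : ∀ j, ZMod (a j)) :
    ∑ x ∈ Finset.range (g ^ n), ind (g ^ n * wordValue t + x ∈ residueClass X f a b) =
      prefixCount X f a n t (b - residue f a (g ^ n * wordValue t)) := by
  rw [← wordSum_wordValue n fun x => ind (g ^ n * wordValue t + x ∈ residueClass X f a b)]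
  refine wordSum_congr fun u hu => ?_
  rw [residueClass, Set.mem_ofPred_eq, add_comm,
    residue_add_pow_mul hg hf (by rw [← hu]; exact wordValue_lt u), eq_sub_iff_add_eq]
  rw [← hu, ← wordValue_append, (ht.append h u).1.mem_languageSet_iff]

variable [IsSofic X] {k : ℕ}

/-- If `t` is readable from `F`, each of the `k ^ n` paths of length `n` into `F` yields an
admissible prefix, and a prefix arises from at most one path per source node. -/
theorem pow_mul_ind_le_wordSum (hX : IsSubshift X) (hmix : IsMixing X) {s : List (Fin g)}
    (hs : IsSynchronizing X s) (hreg : (fischerCover X).IsRegular k) (n : ℕ) (t : List (Fin g)) :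
    (k : ℝ) ^ n * ind (t ∈ lang X) ≤
      Fintype.card (FischerNode X) * wordSum n fun u => ind (u ++ t ∈ lang X) := by
  by_cases ht : t ∈ lang X
  · obtain ⟨F, hF⟩ := exists_node_mem hX hmix hs ht
    rw [ind_of ht, mul_one, ← sum_wordSum_reads_in hX hreg n F, ← nsmul_eq_mul,
      ← Finset.card_univ, ← Finset.sum_const]
    exact Finset.sum_le_sum fun F₀ _ => wordSum_mono fun u _ => ind_mono fun h =>
      FischerNode.mem_lang ((mem_of_reads hX h t).1 hF)
  · rw [ind_of_not ht, mul_zero]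
    exact mul_nonneg (Nat.cast_nonneg _) (wordSum_nonneg fun u => ind_nonneg _)

theorem pow_le_countBelow_languageSet (hX : IsSubshift X) {s : List (Fin g)}
    (hs : IsSynchronizing X s) (hreg : (fischerCover X).IsRegular k) (n : ℕ) :
    (k : ℝ) ^ n ≤ countBelow (languageSet X) (g ^ n) := by
  rw [countBelow, ← wordSum_wordValue n fun x => ind (x ∈ languageSet X),
    ← wordSum_mem_node hX hreg n (FischerNode.ofWord hs)]
  exact wordSum_mono fun w _ => ind_mono fun h => ⟨w, FischerNode.mem_lang h, rfl⟩

theorem tendsto_countBelow_languageSet (hX : IsSubshift X) {s : List (Fin g)}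
    (hs : IsSynchronizing X s) (hk : 2 ≤ k) (hreg : (fischerCover X).IsRegular k) :
    Tendsto (countBelow (languageSet X)) atTop atTop := by
  refine tendsto_atTop.2 fun B => ?_
  obtain ⟨n, hn⟩ := pow_unbounded_of_one_lt B (show (1 : ℝ) < k by exact_mod_cast hk)
  filter_upwards [eventually_ge_atTop (g ^ n)] with N hN
  exact hn.le.trans ((pow_le_countBelow_languageSet hX hs hreg n).trans (countBelow_mono _ hN))

variable [∀ j, NeZero (a j)]

theorem exists_countBelow_le (hg : 2 ≤ g) (hf : ∀ j, IsAdditiveBase g (f j))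
    (hX : IsSubshift X) (hmix : IsMixing X) (hk : 2 ≤ k) (hreg : (fischerCover X).IsRegular k)
    {p l : ℕ} (hper : IsEventualPeriod g f a p l)
    (hsync : ∃ w, IsSynchronizing X w ∧ w.length = l)
    (hMarkov : MarkovCondition X f a k p l) {ε : ℝ} (hε : 0 < ε) :
    ∃ K, ∀ N b b', countBelow (residueClass X f a b) N ≤
      countBelow (residueClass X f a b') N + ε * countBelow (languageSet X) N + K := by
  obtain ⟨s, hs, _⟩ := id hsync
  set C : ℝ := (Fintype.card (FischerNode X) : ℝ)
  have hC : 0 < C := Nat.cast_pos.2 (Fintype.card_pos_iff.2 ⟨FischerNode.ofWord hs⟩)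
  -- By `pow_mul_ind_le_wordSum`, an error `ε / C * k ^ n` is at most `ε` times the count of a block
  -- with `t` in the language.
  obtain ⟨n, hn⟩ := exists_prefixCount_le hg hf hX hmix hk hreg hper hsync hMarkov (div_pos hε hC)
  set G := g ^ n
  have hG : 0 < G := pow_pos (by omega) n
  have hblock : ∀ c b b', ∑ x ∈ Finset.range G, ind (G * c + x ∈ residueClass X f a b) ≤
      ∑ x ∈ Finset.range G, ind (G * c + x ∈ residueClass X f a b') +
        ε * ∑ x ∈ Finset.range G, ind (G * c + x ∈ languageSet X) + if c = 0 then (G : ℝ) else 0 := by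
    intro c b b'
    rcases eq_or_ne c 0 with rfl | hc
    · have h₁ : ∑ x ∈ Finset.range G, ind (G * 0 + x ∈ residueClass X f a b) ≤ G :=
        (Finset.sum_le_sum fun x _ => ind_le_one _).trans (by simp)
      have h₂ : 0 ≤ ∑ x ∈ Finset.range G, ind (G * 0 + x ∈ residueClass X f a b') :=
        Finset.sum_nonneg fun x _ => ind_nonneg _
      have h₃ : 0 ≤ ε * ∑ x ∈ Finset.range G, ind (G * 0 + x ∈ languageSet X) :=
        mul_nonneg hε.le (Finset.sum_nonneg fun x _ => ind_nonneg _)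
      rw [if_pos rfl]
      linarith
    · obtain ⟨t, ht, rfl⟩ := exists_isCanonical hg c
      rw [if_neg hc, add_zero, sum_block_residueClass hg hf ht hc,
        sum_block_residueClass hg hf ht hc, sum_block_language ht hc]
      have hW : 0 ≤ wordSum n fun u => ind (u ++ t ∈ lang X) := wordSum_nonneg fun u => ind_nonneg _
      by_cases htL : t ∈ lang X
      · have h := pow_mul_ind_le_wordSum hX hmix hs hreg n t
        rw [ind_of htL, mul_one] at h
        refine (hn t _ _).trans (add_le_add le_rfl ?_)
        rw [div_mul_eq_mul_div, div_le_iff₀ hC]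
        calc ε * (k : ℝ) ^ n ≤ ε * (C * wordSum n fun u => ind (u ++ t ∈ lang X)) :=
              mul_le_mul_of_nonneg_left h hε.le
          _ = _ := by ring
      · refine le_trans (wordSum_mono fun u _ => ind_mono fun h =>
          (htL (mem_lang_of_append_right hX h.1)).elim)
          (le_add_of_nonneg_right (mul_nonneg hε.le hW))
  -- One `G` pays for the block at the origin, the other for the incomplete last block.
  refine ⟨2 * G, fun N b b' => ?_⟩
  have hN : N = G * (N / G) + N % G := (Nat.div_add_mod N G).symm
  have hle : G * (N / G) ≤ N := Nat.mul_div_le N G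
  have h₁ : countBelow (residueClass X f a b) N ≤
      countBelow (residueClass X f a b) (G * (N / G)) + G := by
    conv_lhs => rw [hN]
    exact (countBelow_add_le _ _ _).trans
      (add_le_add le_rfl (Nat.cast_le.2 (Nat.mod_lt N hG).le))
  have h₂ : countBelow (residueClass X f a b) (G * (N / G)) ≤
      countBelow (residueClass X f a b') (G * (N / G)) +
        ε * countBelow (languageSet X) (G * (N / G)) + G := by
    rw [countBelow_mul, countBelow_mul, countBelow_mul]
    refine (Finset.sum_le_sum fun c _ => hblock c b b').trans ?_
    rw [Finset.sum_add_distrib, Finset.sum_add_distrib, ← Finset.mul_sum]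
    refine add_le_add le_rfl ?_
    rw [Finset.sum_ite_eq']
    split_ifs
    · exact le_rfl
    · exact Nat.cast_nonneg G
  have h₃ := countBelow_mono (residueClass X f a b') hle
  have h₄ := mul_le_mul_of_nonneg_left (countBelow_mono (languageSet X) hle) hε.le
  linarith

omit [IsSofic X] in
theorem sum_countBelow_residueClass (N : ℕ) :
    ∑ b, countBelow (residueClass X f a b) N = countBelow (languageSet X) N := by
  simp only [countBelow]
  rw [Finset.sum_comm]
  refine Finset.sum_congr rfl fun n _ => ?_
  rw [sum_ind_of_unique fun _ _ h₁ h₂ => h₁.2.symm.trans h₂.2]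
  exact congrArg ind (propext ⟨fun ⟨_, h⟩ => h.1, fun h => ⟨_, h, rfl⟩⟩)

end Counting

/-- Finitely many sequences that pairwise differ by a small multiple of their sum, up to a constant,
have asymptotically equal proportions. -/
theorem tendsto_div_of_forall_le {κ : Type*} [Fintype κ] [Nonempty κ] {c : κ → ℕ → ℝ} {S : ℕ → ℝ}
    (hsum : ∀ N, ∑ b, c b N = S N) (hS : Tendsto S atTop atTop)
    (h : ∀ ε > 0, ∃ K, ∀ N b b', c b N ≤ c b' N + ε * S N + K) (b : κ) :
    Tendsto (fun N => c b N / S N) atTop (𝓝 (1 / Fintype.card κ)) := by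
  rw [Metric.tendsto_atTop']
  intro δ hδ
  -- The other half of `δ` absorbs the constant `K` once `S N > 2 * K / δ`.
  obtain ⟨K, hK⟩ := h (δ / 2) (by positivity)
  obtain ⟨N₀, hN₀⟩ := eventually_atTop.1
    ((hS.eventually_gt_atTop 0).and (hS.eventually_gt_atTop (2 * K / δ)))
  refine ⟨N₀, fun N hN => ?_⟩
  obtain ⟨hpos, hlarge⟩ := hN₀ N hN.le
  have hn : (0 : ℝ) < Fintype.card κ := Nat.cast_pos.2 Fintype.card_pos
  rw [div_lt_iff₀ hδ] at hlarge
  -- Summing the comparison over the other index turns it into a comparison with `S N`.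
  have h₁ : Fintype.card κ * c b N ≤ S N + Fintype.card κ * (δ / 2 * S N + K) := by
    rw [← hsum N, ← nsmul_eq_mul, ← nsmul_eq_mul, ← Finset.card_univ, ← Finset.sum_const,
      ← Finset.sum_const, ← Finset.sum_add_distrib, hsum N]
    exact Finset.sum_le_sum fun b' _ => by linarith [hK N b b']
  have h₂ : S N ≤ Fintype.card κ * c b N + Fintype.card κ * (δ / 2 * S N + K) := by
    rw [← mul_add, ← nsmul_eq_mul, ← Finset.card_univ, ← Finset.sum_const]
    conv_lhs => rw [← hsum N]
    exact Finset.sum_le_sum fun b' _ => by linarith [hK N b' b]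
  have h₃ : δ / 2 * S N + K < δ * S N := by linarith
  have h₄ := mul_lt_mul_of_pos_left h₃ hn
  rw [Real.dist_eq, div_sub_div _ _ hpos.ne' hn.ne', abs_div, abs_of_pos (mul_pos hpos hn),
    div_lt_iff₀ (mul_pos hpos hn), abs_lt]
  constructor <;> linarith

end DigitShift

theorem mainTheorem1 (g : ℕ) (hg : 2 ≤ g) (r : ℕ) (a : Fin r → ℕ) [∀ j, NeZero (a j)]
    (f : Fin r → ℕ → ℤ) (hf : ∀ j, IsAdditiveBase g (f j))
    (X : Set (ℕ → Fin g)) (hX : IsSubshift X) (hmix : IsMixing X) [IsSofic X]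
    (k : ℕ) (hk : 2 ≤ k) (hreg : (fischerCover X).IsRegular k)
    (p l : ℕ) (hper : IsEventualPeriod g f a p l)
    (hsync : ∃ w, IsSynchronizing X w ∧ w.length = l)
    (hMarkov : MarkovCondition X f a k p l) :
    IsUniformlyDistributed f a (languageSet X) := by
  intro b
  obtain ⟨s, hs, _⟩ := id hsync
  have h := tendsto_div_of_forall_le (c := fun b => countBelow (residueClass X f a b))
    sum_countBelow_residueClass (tendsto_countBelow_languageSet hX hs hk hreg)
    (fun ε hε => exists_countBelow_le hg hf hX hmix hk hreg hper hsync hMarkov hε) b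
  have hcard : (Fintype.card (∀ j, ZMod (a j)) : ℝ) = ∏ j, (a j : ℝ) := by
    simp [Fintype.card_pi, ZMod.card]
  rw [hcard] at h
  have hset : {n ∈ languageSet X | CongrMod f a n b} = residueClass X f a b := by
    ext n
    simp only [residueClass, congrMod_iff]
  simp only [hset, ncard_inter_Ico]
  exact h
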